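/- Let $G$ be a countable discrete group and let $S\subset G$ be a finite non-empty set that is *amenably-visible*: there is an amenable subgroup $H\le G$ such that $S\cap \gamma^{-1}H\gamma\neq\varnothing$ for all $\gamma\in G$. (A group $H$ is amenable if for every finite $R\subset H$ and $\varepsilon>0$ there is a finite non-empty $F\subset H$ with $|RF\setminus F|<\varepsilon|F|$.) Let $\mathcal M(G)$ be the space of all probability measures on $G$ with the total variation distance $\sum_{g}|\mu(\{g\})-\nu(\{g\})|$, and let $\mathcal M_{\mathrm{sym}}(G)\subset\mathcal M(G)$ be the subspace of symmetric measures ($\nu(\{g^{-1}\})=\nu(\{g\})$ for all $g$). A property holds for a generic measure if it holds on a residual (comeagre) set. A measure is non-degenerate if its support generates $G$ as a semigroup. For a probability measure $\nu$ on $G$ let $\eta$ be the distribution on $\Omega=\prod_{i\ge1}G$ of the random walk $Z_i=X_1\cdots X_i$, where $X_1,X_2,\dots$ are independent with distribution $\nu$; let $G$ act on $\Omega$ by $\gamma(g_1,g_2,\dots)=(\gamma g_1,\gamma g_2,\dots)$, and let $\mathscr A_\infty$ be the tail $\sigma$-algebra of $\Omega$. For non-degenerate $\nu$, the Poisson boundary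 $\partial(G,\nu)$ is a standard Borel space with a Borel map $\pi:\Omega\to\partial(G,\nu)$ such that $\mathscr A_\infty$ is, modulo $\eta$-null sets, the preimage under $\pi$ of the Borel $\sigma$-algebra, endowed with the measure $\pi_*\eta$ and with a Borel action of $G$ for which $\pi_*\eta$ is quasi-invariant and $\pi(\gamma\omega)=\gamma\pi(\omega)$ for every $\gamma\in G$ and $\eta$-almost every $\omega$. Then a generic $\nu\in\mathcal M(G)$ is non-degenerate, has a Poisson boundary, and for every realization of $\partial(G,\nu)$ as above, the stabilizer of almost every point of $\partial(G,\nu)$ has a non-empty intersection with $S$. The same holds for a generic $\nu\in\mathcal M_{\mathrm{sym}}(G)$. -/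

import Mathlib

open MeasureTheory Filter Topology
open scoped ENNReal

universe u v

/-! ### Amenability and amenably-visible sets -/

/-- Amenability of a discrete group, as the Følner condition: for every finite `R` and every
`ε > 0` there is a finite non-empty `(R, ε)`-invariant set `F`, i.e. `|RF \ F| < ε |F|`. -/
def IsAmenableGroup (H : Type*) [Group H] : Prop :=
  ∀ (R : Set H) (ε : ℝ), R.Finite → 0 < ε →
    ∃ F : Set H, F.Finite ∧ F.Nonempty ∧ ((Set.image2 (· * ·) R F \ F).ncard : ℝ) < ε * F.ncard

/-- A finite set `S` is amenably-visible if for some amenable subgroup `H` the set `S` meets every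
conjugate `H ^ γ = γ⁻¹ H γ`. -/
def AmenablyVisible {G : Type*} [Group G] (S : Finset G) : Prop :=
  ∃ H : Subgroup G, IsAmenableGroup H ∧ ∀ γ : G, ∃ s ∈ S, ∃ h ∈ H, s = γ⁻¹ * h * γ

/-! ### The space of probability measures with the total variation norm -/

/-- The space of probability measures on a countable set `X`, each identified with the function
`x ↦ ν {x}`, with the metric of `ℓ¹ X`; thus `dist μ ν = ∑ |μ {x} - ν {x}|` is the total
variation norm of `μ - ν`. -/
abbrev ProbSpace (X : Type u) : Type u :=
  {p : lp (fun _ : X => ℝ) 1 // (∀ x, 0 ≤ p x) ∧ HasSum (fun x => p x) 1}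

namespace ProbSpace

variable {G : Type u}

/-- The probability measure with point masses `ν {x}`. -/
noncomputable def toMeasure [MeasurableSpace G] (ν : ProbSpace G) : Measure G :=
  Measure.sum fun x => ENNReal.ofReal (ν.1 x) • Measure.dirac x

instance [MeasurableSpace G] (ν : ProbSpace G) : IsProbabilityMeasure ν.toMeasure := by
  constructor
  rw [toMeasure, Measure.sum_apply _ MeasurableSet.univ]
  simp only [Measure.smul_apply, measure_univ, smul_eq_mul, mul_one]
  rw [← ENNReal.ofReal_tsum_of_nonneg ν.2.1 ν.2.2.summable, ν.2.2.tsum_eq, ENNReal.ofReal_one]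

/-- `ν` is symmetric: `ν {g⁻¹} = ν {g}`. -/
def IsSymmetric [Group G] (ν : ProbSpace G) : Prop := ∀ g : G, ν.1 g⁻¹ = ν.1 g

/-- `ν` is non-degenerate: its support generates `G` as a semigroup. -/
def IsNondegenerate [Group G] (ν : ProbSpace G) : Prop :=
  Subsemigroup.closure {g : G | ν.1 g ≠ 0} = ⊤

end ProbSpace

/-! ### The random walk and its Poisson boundary -/

namespace RandomWalk

/-- From the increments `X₁, X₂, …` to the positions `Zᵢ = X₁ ⋯ Xᵢ`; the index of the sequences is
shifted by one, so the entry number `0` is `X₁`, respectively `Z₁`. -/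
def positions {G : Type u} [Group G] (x : ℕ → G) : ℕ → G
  | 0 => x 0
  | n + 1 => positions x n * x (n + 1)

/-- The measure `η` on the path space: the distribution of `(Z₁, Z₂, …)`, where the increments are
independent with distribution `ν`. -/
noncomputable def pathMeasure {G : Type u} [Group G] [MeasurableSpace G] (ν : ProbSpace G) :
    Measure (ℕ → G) :=
  (Measure.infinitePi fun _ : ℕ => ν.toMeasure).map positions

/-- The action of `G` on the path space, `γ (g₁, g₂, …) = (γ g₁, γ g₂, …)`. -/
def translate {G : Type u} [Group G] (γ : G) (ω : ℕ → G) : ℕ → G := fun i => γ * ω i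

/-- The `σ`-algebra generated by the coordinates with index at least `n`. -/
@[reducible] def fromTime (G : Type u) [MeasurableSpace G] (n : ℕ) : MeasurableSpace (ℕ → G) :=
  ⨆ i : ℕ, ⨆ _ : n ≤ i, MeasurableSpace.comap (fun ω : ℕ → G => ω i) inferInstance

/-- The tail `σ`-algebra of the path space. -/
@[reducible] def tail (G : Type u) [MeasurableSpace G] : MeasurableSpace (ℕ → G) := ⨅ n : ℕ, fromTime G n

end RandomWalk

open RandomWalk

/-- The space `B`, with the action of `G`, the map `π` from the path space and the measure
`(pathMeasure ν).map π`, is (a realization of) the Poisson boundary `∂(G, ν)` of a non-degenerate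
`ν`: up to null sets, the tail `σ`-algebra is the preimage under `π` of the Borel `σ`-algebra of
`B`, the map `π` is equivariant, and `G` acts by Borel, quasi-invariant transformations. -/
structure IsPoissonBoundary {G : Type u} [Group G] [MeasurableSpace G] (ν : ProbSpace G)
    (B : Type v) [MeasurableSpace B] [MulAction G B] (π : (ℕ → G) → B) : Prop where
  measurable_map : Measurable π
  preimage_tail : ∀ C : Set B, MeasurableSet C →
    ∃ A : Set (ℕ → G), MeasurableSet[tail G] A ∧ π ⁻¹' C =ᵐ[pathMeasure ν] A
  tail_preimage : ∀ A : Set (ℕ → G), MeasurableSet[tail G] A →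
    ∃ C : Set B, MeasurableSet C ∧ A =ᵐ[pathMeasure ν] π ⁻¹' C
  equivariant : ∀ γ : G, ∀ᵐ ω ∂(pathMeasure ν), π (translate γ ω) = γ • π ω
  quasiInvariant : ∀ γ : G, Measure.QuasiMeasurePreserving (fun b : B => γ • b)
    ((pathMeasure ν).map π) ((pathMeasure ν).map π)

/-- `ν` has a Poisson boundary. -/
def HasPoissonBoundary {G : Type u} [Group G] [MeasurableSpace G] (ν : ProbSpace G) : Prop :=
  ∃ (B : Type u) (_ : MeasurableSpace B) (_ : StandardBorelSpace B) (_ : MulAction G B)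
    (π : (ℕ → G) → B), IsPoissonBoundary ν B π

/-- The stabilizer of almost every point of the Poisson boundary `∂(G, ν)` meets `S`. The Poisson
boundary is unique up to isomorphism; the property is stated for all of its realizations. -/
def BoundaryStabilizersMeet {G : Type u} [Group G] [MeasurableSpace G] (ν : ProbSpace G)
    (S : Finset G) : Prop :=
  ∀ (B : Type v) [MeasurableSpace B] [StandardBorelSpace B] [MulAction G B] (π : (ℕ → G) → B),
    IsPoissonBoundary ν B π →
      ∀ᵐ b ∂((pathMeasure ν).map π), ((S : Set G) ∩ MulAction.stabilizer G b).Nonempty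

/-! ### Existence of the Poisson boundary for measures of full support -/

namespace RandomWalk

theorem exists_dense_seq {Ω : Type*} (m : MeasurableSpace Ω) [m0 : MeasurableSpace Ω]
    [MeasurableSpace.CountablyGenerated Ω] (η : Measure Ω) [IsProbabilityMeasure η]
    (hm : m ≤ m0) :
    ∃ F : ℕ → Set Ω, (∀ n, MeasurableSet[m] (F n)) ∧
      ∀ A, MeasurableSet[m] A → ∀ δ : ℝ, 0 < δ → ∃ n, η (symmDiff A (F n)) < ENNReal.ofReal δ := by
  classical
  obtain ⟨D, hDc, hD⟩ := exists_countable_measureDense (μ := η)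
  obtain ⟨a, ha⟩ := hDc.exists_eq_range hD.nonempty
  let P : ℕ → ℕ → Set Ω → Prop := fun i n A =>
    MeasurableSet[m] A ∧ η (symmDiff A (a i)) < ENNReal.ofReal (1 / (n + 1))
  let F : ℕ → ℕ → Set Ω := fun i n => if h : ∃ A, P i n A then h.choose else ∅
  have hF : ∀ i n, MeasurableSet[m] (F i n) := by
    intro i n
    by_cases h : ∃ A, P i n A
    · simp only [F, dif_pos h]; exact h.choose_spec.1
    · simp only [F, dif_neg h]; exact @MeasurableSet.empty _ m
  refine ⟨fun k => F k.unpair.1 k.unpair.2, fun k => hF _ _, fun A hA δ hδ => ?_⟩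
  obtain ⟨n, hn⟩ := exists_nat_one_div_lt (half_pos hδ)
  obtain ⟨t, ht, hAt⟩ := hD.approx A (hm _ hA) (measure_ne_top _ _) (1 / (n + 1)) (by positivity)
  rw [ha] at ht
  obtain ⟨i, rfl⟩ := ht
  have hex : ∃ A, P i n A := ⟨A, hA, hAt⟩
  have hFin : η (symmDiff (F i n) (a i)) < ENNReal.ofReal (1 / (n + 1)) := by
    simp only [F, dif_pos hex]; exact hex.choose_spec.2
  refine ⟨Nat.pair i n, ?_⟩
  simp only [Nat.unpair_pair]
  calc η (symmDiff A (F i n)) ≤ η (symmDiff A (a i)) + η (symmDiff (a i) (F i n)) :=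
        measure_symmDiff_le _ _ _
    _ < ENNReal.ofReal (1 / (n + 1)) + ENNReal.ofReal (1 / (n + 1)) := by
        rw [symmDiff_comm (a i)]; exact ENNReal.add_lt_add hAt hFin
    _ = ENNReal.ofReal (1 / (n + 1) + 1 / (n + 1)) :=
        (ENNReal.ofReal_add (by positivity) (by positivity)).symm
    _ ≤ ENNReal.ofReal δ := ENNReal.ofReal_le_ofReal (by linarith)

section

set_option linter.unusedSectionVars false

variable {G : Type u} [Group G] [Countable G] [MeasurableSpace G] [DiscreteMeasurableSpace G]

theorem fromTime_le (n : ℕ) : fromTime G n ≤ MeasurableSpace.pi :=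
  iSup₂_le fun i _ => (measurable_pi_apply i).comap_le

theorem tail_le : tail G ≤ MeasurableSpace.pi := (iInf_le _ 0).trans (fromTime_le 0)

theorem measurable_translate (γ : G) : Measurable (translate γ : (ℕ → G) → ℕ → G) :=
  measurable_pi_lambda _ fun i => (measurable_const_mul γ).comp (measurable_pi_apply i)

theorem measurable_translate_tail (γ : G) :
    Measurable[tail G, tail G] (translate γ : (ℕ → G) → ℕ → G) := by
  have key : ∀ n, Measurable[fromTime G n, fromTime G n] (translate γ : (ℕ → G) → ℕ → G) := by
    intro n
    rw [measurable_iff_comap_le]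
    simp only [fromTime, MeasurableSpace.comap_iSup, MeasurableSpace.comap_comp]
    refine iSup₂_le fun i hi => ?_
    refine le_trans ?_ (le_iSup₂_of_le i hi le_rfl)
    rw [← measurable_iff_comap_le]
    exact (measurable_const_mul γ).comp (comap_measurable _)
  intro A hA
  rw [tail, MeasurableSpace.measurableSet_iInf] at hA ⊢
  exact fun n => key n (hA n)

theorem measurable_positions : Measurable (positions : (ℕ → G) → ℕ → G) := by
  refine measurable_pi_lambda _ fun n => ?_
  induction n with
  | zero => exact measurable_pi_apply 0
  | succ n ih => exact ih.mul (measurable_pi_apply (n + 1))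

instance (ν : ProbSpace G) : IsProbabilityMeasure (pathMeasure ν) :=
  Measure.isProbabilityMeasure_map measurable_positions.aemeasurable

/-- The sequence with first entry `p.1`, followed by `p.2`. -/
def consSeq (p : G × (ℕ → G)) : ℕ → G
  | 0 => p.1
  | n + 1 => p.2 n

theorem measurable_consSeq : Measurable (consSeq : G × (ℕ → G) → ℕ → G) := by
  refine measurable_pi_lambda _ fun n => ?_
  cases n with
  | zero => exact measurable_fst
  | succ n => exact (measurable_pi_apply n).comp measurable_snd

theorem map_consSeq (μ : Measure G) [IsProbabilityMeasure μ] :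
    (μ.prod (Measure.infinitePi fun _ : ℕ => μ)).map consSeq =
      Measure.infinitePi fun _ : ℕ => μ := by
  classical
  refine Measure.eq_infinitePi _ fun s t ht => ?_
  rw [Measure.map_apply measurable_consSeq (MeasurableSet.pi s.countable_toSet fun i _ => ht i)]
  let t' : ℕ → Set G := fun i => if i ∈ s then t i else Set.univ
  let N := s.sup id
  have hN : ∀ i ∈ s, i < N + 1 := fun i hi => Nat.lt_succ_of_le (Finset.le_sup (f := id) hi)
  have hset : consSeq ⁻¹' (s : Set ℕ).pi t =
      t' 0 ×ˢ ((Finset.range N : Set ℕ).pi fun i => t' (i + 1)) := by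
    ext p
    simp only [Set.mem_preimage, Set.mem_pi, Finset.mem_coe, Set.mem_prod, Finset.mem_range, t']
    constructor
    · intro h
      refine ⟨?_, fun i _ => ?_⟩
      · split_ifs with h0
        · exact h 0 h0
        · trivial
      · split_ifs with h0
        · exact h (i + 1) h0
        · trivial
    · rintro ⟨h0, h1⟩ i hi
      cases i with
      | zero => simpa [hi, consSeq] using h0
      | succ i => simpa [hi, consSeq] using h1 i (by have := hN _ hi; omega)
  rw [hset, Measure.prod_prod, Measure.infinitePi_pi _ (fun i _ => MeasurableSet.of_discrete),
    mul_comm, ← Finset.prod_range_succ' (fun i => μ (t' i))]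
  rw [← Finset.prod_subset (s₁ := s) (fun i hi => Finset.mem_range.2 (hN i hi))]
  · exact Finset.prod_congr rfl fun i hi => by simp [t', hi]
  · intro i _ hi
    simp [t', hi]

theorem translate_positions (γ g : G) (x : ℕ → G) :
    translate γ (positions (consSeq (g, x))) = positions (consSeq (γ * g, x)) := by
  funext n
  induction n with
  | zero => rfl
  | succ n ih =>
    simp only [translate, positions] at ih ⊢
    rw [← ih, mul_assoc]
    rfl

theorem toMeasure_singleton (ν : ProbSpace G) (g : G) :
    ν.toMeasure {g} = ENNReal.ofReal (ν.1 g) := by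
  classical
  rw [ProbSpace.toMeasure, Measure.sum_apply _ (measurableSet_singleton g)]
  rw [tsum_eq_single g]
  · simp
  · intro b hb
    simp [hb]

/-- For a measure of full support the translates of the path measure are absolutely continuous. -/
theorem map_translate_absolutelyContinuous (ν : ProbSpace G) (hν : ∀ g, ν.1 g ≠ 0) (γ : G) :
    (pathMeasure ν).map (translate γ) ≪ pathMeasure ν := by
  have hac : ∀ μ : Measure G, μ ≪ ν.toMeasure := by
    intro μ s hs
    have : s = ∅ := by
      by_contra hne
      obtain ⟨g, hg⟩ := Set.nonempty_iff_ne_empty.2 hne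
      have h0 := measure_mono_null (Set.singleton_subset_iff.2 hg) hs
      rw [toMeasure_singleton, ENNReal.ofReal_eq_zero] at h0
      exact hν g (le_antisymm h0 (ν.2.1 g))
    simp [this]
  have hm := measurable_positions (G := G)
  have hc := measurable_consSeq (G := G)
  set P := Measure.infinitePi fun _ : ℕ => ν.toMeasure with hP
  have h1 : pathMeasure ν = (ν.toMeasure.prod P).map (positions ∘ consSeq) := by
    rw [← Measure.map_map hm hc, hP, map_consSeq, pathMeasure]
  have h2 : (pathMeasure ν).map (translate γ) =
      ((ν.toMeasure.map (γ * ·)).prod P).map (positions ∘ consSeq) := by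
    have : (ν.toMeasure.map (γ * ·)).prod P =
        (ν.toMeasure.prod P).map (Prod.map (γ * ·) id) := by
      rw [← Measure.map_prod_map _ _ (measurable_const_mul γ) measurable_id, Measure.map_id]
    rw [this, h1, Measure.map_map (measurable_translate γ) (hm.comp hc),
      Measure.map_map (hm.comp hc) ((measurable_const_mul γ).prodMap measurable_id)]
    congr 1
    funext p
    exact translate_positions γ p.1 p.2
  rw [h2, h1]
  exact ((hac _).prod Measure.AbsolutelyContinuous.rfl).map (hm.comp hc)

/-- The space in which the Poisson boundary is realized below, with `G` acting by shifts. -/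
abbrev ShiftSpace (G : Type u) : Type u := G → ℕ → Bool

/-- The shift action of `G`. -/
@[reducible] def shiftAction : MulAction G (ShiftSpace G) where
  smul γ b := fun g => b (γ⁻¹ * g)
  one_smul b := by funext g; change b ((1 : G)⁻¹ * g) = b g; simp
  mul_smul γ δ b := by
    funext g
    change b ((γ * δ)⁻¹ * g) = b (δ⁻¹ * (γ⁻¹ * g))
    simp [mul_assoc]

/-- A measure of full support has a Poisson boundary. -/
theorem hasPoissonBoundary (ν : ProbSpace G) (hν : ∀ g, ν.1 g ≠ 0) : HasPoissonBoundary ν := by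
  classical
  obtain ⟨F, hF, hdense⟩ := exists_dense_seq (tail G) (pathMeasure ν) tail_le
  let π : (ℕ → G) → ShiftSpace G := fun ω g n => decide (translate g⁻¹ ω ∈ F n)
  have hπt : Measurable[tail G] π := by
    refine @measurable_pi_lambda _ _ _ (tail G) _ _ fun g => ?_
    refine @measurable_pi_lambda _ _ _ (tail G) _ _ fun n => ?_
    have hset : MeasurableSet[tail G] {ω | translate g⁻¹ ω ∈ F n} :=
      measurable_translate_tail g⁻¹ (hF n)
    refine @measurable_to_bool _ (tail G) _ ?_
    convert hset using 1
    ext ω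
    simp [π]
  have hπ : Measurable π := hπt.mono tail_le le_rfl
  let _ := shiftAction (G := G)
  have hequiv : ∀ (γ : G) (ω : ℕ → G), π (translate γ ω) = γ • π ω := by
    intro γ ω
    funext g n
    change decide (translate g⁻¹ (translate γ ω) ∈ F n) =
      decide (translate (γ⁻¹ * g)⁻¹ ω ∈ F n)
    have : translate g⁻¹ (translate γ ω) = translate (γ⁻¹ * g)⁻¹ ω := by
      funext i; simp [translate, mul_assoc]
    rw [this]
  have hsm : ∀ γ : G, Measurable (fun b : ShiftSpace G => γ • b) := fun γ =>
    measurable_pi_lambda _ fun g => measurable_pi_apply (γ⁻¹ * g)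
  refine ⟨ShiftSpace G, inferInstance, inferInstance, shiftAction, π, hπ, ?_, ?_, ?_, ?_⟩
  · exact fun C hC => ⟨π ⁻¹' C, hπt hC, Filter.EventuallyEq.rfl⟩
  · intro A hA
    choose k hk using fun j : ℕ => hdense A hA ((1 / 2) ^ j) (by positivity)
    refine ⟨{b | ∃ᶠ j in atTop, b 1 (k j) = true}, ?_, ?_⟩
    · have : {b : ShiftSpace G | ∃ᶠ j in atTop, b 1 (k j) = true} =
          ⋂ n, ⋃ j, ⋃ _ : n ≤ j, {b : ShiftSpace G | b 1 (k j) = true} := by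
        ext b; simp [Filter.frequently_atTop]
      rw [this]
      refine MeasurableSet.iInter fun n => MeasurableSet.iUnion fun j => MeasurableSet.iUnion
        fun _ => ?_
      have hm : Measurable fun b : ShiftSpace G => b 1 (k j) :=
        (measurable_pi_apply (k j)).comp (measurable_pi_apply (1 : G))
      exact hm (measurableSet_singleton true)
    · have hsum : ∑' j, pathMeasure ν (symmDiff A (F (k j))) ≠ ∞ := by
        refine ne_top_of_le_ne_top ?_ (ENNReal.tsum_le_tsum fun j => (hk j).le)
        rw [← ENNReal.ofReal_tsum_of_nonneg (fun j => by positivity) summable_geometric_two]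
        exact ENNReal.ofReal_ne_top
      filter_upwards [ae_eventually_notMem hsum] with ω hω
      apply propext
      change ω ∈ A ↔ ∃ᶠ j in atTop, decide (translate (1 : G)⁻¹ ω ∈ F (k j)) = true
      have h1 : translate (1 : G)⁻¹ ω = ω := by funext i; simp [translate]
      simp only [h1, decide_eq_true_eq]
      have hev : ∀ᶠ j in atTop, (ω ∈ A ↔ ω ∈ F (k j)) := by
        filter_upwards [hω] with j hj
        rw [Set.mem_symmDiff] at hj
        tauto
      rw [← Filter.frequently_congr hev]
      simp
  · exact fun γ => Filter.Eventually.of_forall (hequiv γ)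
  · refine fun γ => ⟨hsm γ, ?_⟩
    rw [Measure.map_map (hsm γ) hπ]
    have : (fun b : ShiftSpace G => γ • b) ∘ π = π ∘ translate γ :=
      funext fun ω => (hequiv γ ω).symm
    rw [this, ← Measure.map_map hπ (measurable_translate γ)]
    exact (map_translate_absolutelyContinuous ν hν γ).map hπ

end

end RandomWalk

/-! Suppose a small part `δ` of `ν` is replaced by a finitely supported symmetric measure `μ` on the
amenable subgroup `H`, almost invariant under left multiplication by a given finite subset of `H`.
An increment is then drawn from `μ` with probability `δ`, otherwise from `ν`. Consider the first
increment `g` drawn from `μ`, and let `z` be the position just before it. By visibility some `s ∈ S`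
has `z⁻¹ s z ∈ H`. Replacing `g` by `z⁻¹ s z g` hardly changes the law of `g`, yet multiplies all
later positions by `s` on the left. For small `δ` the swap probably happens after time `M`, so the
first `M` increments are untouched. This is `exists_isSwapping_mix`, resting on
`abs_expect_swapWeight_le` and `le_expect_sum_swapWeight`.

`IsSwapping` records the outcome through bounded functions of finitely many increments, so it
survives small perturbations in total variation with `ε` doubled. Small mixtures with symmetric
measures are therefore enough to make full support and swapping for all `M` and `ε` generic, both in
the whole space and among symmetric measures.

A tail event is approximated by an event of the first `M` increments, which the swap preserves;
hence it rarely distinguishes a path `ω` from `s ω` for the selected `s` (`integral_swap_le`). So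
almost no path is separated from all its translates by `S` by finitely many tail events. In the
boundary, countably many Borel sets separate points; a point moved by every `s` in the finite set
`S` would be separated from all its translates by finitely many of them. -/

namespace ProbSpace

variable {G : Type u}

/-! ### Expectations with respect to finitely many increments -/

theorem dist_eq_tsum (ν μ : ProbSpace G) : dist ν μ = ∑' g, |ν.1 g - μ.1 g| := by
  rw [Subtype.dist_eq, dist_eq_norm, lp.norm_eq_tsum_rpow (by simp)]
  simp [Real.norm_eq_abs]

theorem summable_abs_sub (ν μ : ProbSpace G) : Summable fun g => |ν.1 g - μ.1 g| :=
  (ν.2.2.summable.sub μ.2.2.summable).abs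

theorem abs_apply_sub_le_dist (ν μ : ProbSpace G) (g : G) : |ν.1 g - μ.1 g| ≤ dist ν μ := by
  rw [dist_eq_tsum]
  exact (summable_abs_sub ν μ).le_tsum g fun _ _ => abs_nonneg _

/-- The mean of `a` with respect to `ν`. -/
noncomputable def mean (ν : ProbSpace G) (a : G → ℝ) : ℝ := ∑' g, ν.1 g * a g

theorem summable_mul (ν : ProbSpace G) {a : G → ℝ} {C : ℝ} (ha : ∀ g, |a g| ≤ C) :
    Summable fun g => ν.1 g * a g := by
  refine Summable.of_norm_bounded (ν.2.2.summable.mul_right C) fun g => ?_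
  rw [Real.norm_eq_abs, abs_mul, abs_of_nonneg (ν.2.1 g)]
  exact mul_le_mul_of_nonneg_left (ha g) (ν.2.1 g)

theorem mean_const (ν : ProbSpace G) (c : ℝ) : ν.mean (fun _ => c) = c := by
  rw [mean, tsum_mul_right, ν.2.2.tsum_eq, one_mul]

theorem mean_const_mul (ν : ProbSpace G) (c : ℝ) (a : G → ℝ) :
    ν.mean (fun g => c * a g) = c * ν.mean a := by
  rw [mean, mean, ← tsum_mul_left]
  exact tsum_congr fun g => by ring

theorem mean_add (ν : ProbSpace G) {a b : G → ℝ} {C D : ℝ} (ha : ∀ g, |a g| ≤ C)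
    (hb : ∀ g, |b g| ≤ D) : ν.mean (fun g => a g + b g) = ν.mean a + ν.mean b := by
  rw [mean, mean, mean, ← (ν.summable_mul ha).tsum_add (ν.summable_mul hb)]
  exact tsum_congr fun g => by ring

theorem mean_sub (ν : ProbSpace G) {a b : G → ℝ} {C D : ℝ} (ha : ∀ g, |a g| ≤ C)
    (hb : ∀ g, |b g| ≤ D) : ν.mean (fun g => a g - b g) = ν.mean a - ν.mean b := by
  rw [mean, mean, mean, ← (ν.summable_mul ha).tsum_sub (ν.summable_mul hb)]
  exact tsum_congr fun g => by ring

theorem mean_mono (ν : ProbSpace G) {a b : G → ℝ} {C D : ℝ} (ha : ∀ g, |a g| ≤ C)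
    (hb : ∀ g, |b g| ≤ D) (hab : ∀ g, a g ≤ b g) : ν.mean a ≤ ν.mean b :=
  (ν.summable_mul ha).tsum_le_tsum (fun g => mul_le_mul_of_nonneg_left (hab g) (ν.2.1 g))
    (ν.summable_mul hb)

theorem abs_mean_le (ν : ProbSpace G) {a b : G → ℝ} {D : ℝ} (hb : ∀ g, |b g| ≤ D)
    (hab : ∀ g, |a g| ≤ b g) : |ν.mean a| ≤ ν.mean b := by
  have ha : ∀ g, |a g| ≤ D := fun g => (hab g).trans ((le_abs_self _).trans (hb g))
  refine abs_le.2 ⟨?_, ν.mean_mono ha hb fun g => (le_abs_self _).trans (hab g)⟩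
  have h := ν.mean_mono (a := fun g => (-1) * b g) (b := a) (C := D)
    (fun g => by simpa using hb g) ha (fun g => by have := (abs_le.1 (hab g)).1; linarith)
  rw [mean_const_mul] at h
  linarith

theorem abs_mean_le_const (ν : ProbSpace G) {a : G → ℝ} {C : ℝ} (ha : ∀ g, |a g| ≤ C) :
    |ν.mean a| ≤ C := by
  simpa only [mean_const] using ν.abs_mean_le (b := fun _ => C) (fun _ => le_rfl) ha

theorem abs_mean_sub_mean_le (ν μ : ProbSpace G) {a b : G → ℝ} {C D : ℝ} (ha : ∀ g, |a g| ≤ C)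
    (hb : ∀ g, |b g| ≤ C) (hab : ∀ g, |a g - b g| ≤ D) :
    |ν.mean a - μ.mean b| ≤ C * dist ν μ + D := by
  have h1 : ν.mean a - μ.mean b = ∑' g, (ν.1 g - μ.1 g) * a g + μ.mean (fun g => a g - b g) := by
    have e : (fun g => (ν.1 g - μ.1 g) * a g) = fun g => ν.1 g * a g - μ.1 g * a g :=
      funext fun g => by ring
    rw [e, (ν.summable_mul ha).tsum_sub (μ.summable_mul ha)]
    rw [μ.mean_sub ha hb]
    simp only [mean]
    ring
  have h2 : |∑' g, (ν.1 g - μ.1 g) * a g| ≤ C * dist ν μ := by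
    rw [dist_eq_tsum, ← tsum_mul_left, ← Real.norm_eq_abs]
    refine tsum_of_norm_bounded ((summable_abs_sub ν μ).mul_left C).hasSum fun g => ?_
    rw [Real.norm_eq_abs, abs_mul, mul_comm]
    exact mul_le_mul_of_nonneg_right (ha g) (abs_nonneg _)
  rw [h1]
  exact (abs_add_le _ _).trans (add_le_add h2 (μ.abs_mean_le_const hab))

/-- The expectation of a function of `n` independent increments with distribution `ν`. -/
noncomputable def expect (ν : ProbSpace G) : ℕ → (List G → ℝ) → ℝ
  | 0, φ => φ []
  | n + 1, φ => ν.mean fun g => expect ν n fun l => φ (g :: l)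

theorem abs_expect_le (ν : ProbSpace G) {C : ℝ} (n : ℕ) {φ : List G → ℝ} (hφ : ∀ l, |φ l| ≤ C) :
    |ν.expect n φ| ≤ C := by
  induction n generalizing φ with
  | zero => exact hφ []
  | succ n ih => exact ν.abs_mean_le_const fun g => ih fun l => hφ _

theorem expect_congr (ν : ProbSpace G) (n : ℕ) {φ ψ : List G → ℝ}
    (h : ∀ l : List G, l.length = n → φ l = ψ l) : ν.expect n φ = ν.expect n ψ := by
  induction n generalizing φ ψ with
  | zero => exact h [] rfl
  | succ n ih =>
    simp only [expect]
    congr 1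
    exact funext fun g => ih fun l hl => h _ (by simp [hl])

theorem expect_const (ν : ProbSpace G) (n : ℕ) (c : ℝ) : ν.expect n (fun _ => c) = c := by
  induction n with
  | zero => rfl
  | succ n ih => simp only [expect, ih, mean_const]

theorem expect_const_mul (ν : ProbSpace G) (n : ℕ) (c : ℝ) (φ : List G → ℝ) :
    ν.expect n (fun l => c * φ l) = c * ν.expect n φ := by
  induction n generalizing φ with
  | zero => rfl
  | succ n ih => simp only [expect, ih, mean_const_mul]

theorem expect_add (ν : ProbSpace G) {C D : ℝ} (n : ℕ) {φ ψ : List G → ℝ} (hφ : ∀ l, |φ l| ≤ C)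
    (hψ : ∀ l, |ψ l| ≤ D) : ν.expect n (fun l => φ l + ψ l) = ν.expect n φ + ν.expect n ψ := by
  induction n generalizing φ ψ with
  | zero => rfl
  | succ n ih =>
    simp only [expect]
    rw [← ν.mean_add (fun g => ν.abs_expect_le n fun l => hφ _)
      (fun g => ν.abs_expect_le n fun l => hψ _)]
    congr 1
    exact funext fun g => ih (fun l => hφ _) (fun l => hψ _)

theorem expect_sub (ν : ProbSpace G) {C D : ℝ} (n : ℕ) {φ ψ : List G → ℝ} (hφ : ∀ l, |φ l| ≤ C)
    (hψ : ∀ l, |ψ l| ≤ D) : ν.expect n (fun l => φ l - ψ l) = ν.expect n φ - ν.expect n ψ := by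
  have h := ν.expect_add n hφ (ψ := fun l => -1 * ψ l) (D := D) fun l => by simpa using hψ l
  rw [expect_const_mul] at h
  simpa [sub_eq_add_neg] using h

theorem expect_nonneg (ν : ProbSpace G) (n : ℕ) {φ : List G → ℝ} (hφ : ∀ l, 0 ≤ φ l) :
    0 ≤ ν.expect n φ := by
  induction n generalizing φ with
  | zero => exact hφ []
  | succ n ih => exact tsum_nonneg fun g => mul_nonneg (ν.2.1 g) (ih fun l => hφ _)

/-- The increments are exchanged one at a time, each at the cost `C * dist ν μ`. -/
theorem abs_expect_sub_expect_le (ν μ : ProbSpace G) {C : ℝ} (n : ℕ) {φ : List G → ℝ}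
    (hφ : ∀ l, |φ l| ≤ C) : |ν.expect n φ - μ.expect n φ| ≤ n * (C * dist ν μ) := by
  induction n generalizing φ with
  | zero => simp [expect]
  | succ n ih =>
    refine (abs_mean_sub_mean_le ν μ (fun g => ν.abs_expect_le n fun l => hφ _)
      (fun g => μ.abs_expect_le n fun l => hφ _) (fun g => ih fun l => hφ _)).trans ?_
    push_cast
    linarith

/-! ### Mixtures and uniform measures -/

/-- The probability measure with the point masses `p`. -/
noncomputable def ofHasSum (p : G → ℝ) (h0 : ∀ g, 0 ≤ p g) (h1 : HasSum p 1) : ProbSpace G :=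
  ⟨⟨p, memℓp_gen (by simpa using h1.summable.abs)⟩, h0, h1⟩

/-- The mixture `(1 - δ) ν + δ μ`. -/
noncomputable def mix (δ : ℝ) (h0 : 0 ≤ δ) (h1 : δ ≤ 1) (ν μ : ProbSpace G) : ProbSpace G :=
  ofHasSum (fun g => (1 - δ) * ν.1 g + δ * μ.1 g)
    (fun g => add_nonneg (mul_nonneg (by linarith) (ν.2.1 g)) (mul_nonneg h0 (μ.2.1 g)))
    (by simpa using (ν.2.2.mul_left (1 - δ)).add (μ.2.2.mul_left δ))

theorem mix_apply (δ : ℝ) (h0 : 0 ≤ δ) (h1 : δ ≤ 1) (ν μ : ProbSpace G) (g : G) :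
    (mix δ h0 h1 ν μ).1 g = (1 - δ) * ν.1 g + δ * μ.1 g := rfl

theorem dist_mix_le (δ : ℝ) (h0 : 0 ≤ δ) (h1 : δ ≤ 1) (ν μ : ProbSpace G) :
    dist (mix δ h0 h1 ν μ) ν ≤ 2 * δ := by
  rw [dist_eq_tsum]
  have h : HasSum (fun g => δ * (ν.1 g + μ.1 g)) (2 * δ) := by
    have := (ν.2.2.add μ.2.2).mul_left δ
    rwa [show δ * (1 + 1) = 2 * δ by ring] at this
  rw [← h.tsum_eq]
  refine (summable_abs_sub _ _).tsum_le_tsum (fun g => ?_) h.summable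
  have e : (mix δ h0 h1 ν μ).1 g - ν.1 g = δ * (μ.1 g - ν.1 g) := by rw [mix_apply]; ring
  rw [e, abs_mul, abs_of_nonneg h0]
  refine mul_le_mul_of_nonneg_left (abs_le.2 ⟨?_, ?_⟩) h0 <;>
    linarith [ν.2.1 g, μ.2.1 g]

theorem IsSymmetric.mix [Group G] {δ : ℝ} (h0 : 0 ≤ δ) (h1 : δ ≤ 1) {ν μ : ProbSpace G}
    (hν : ν.IsSymmetric) (hμ : μ.IsSymmetric) : (mix δ h0 h1 ν μ).IsSymmetric := fun g => by
  rw [mix_apply, mix_apply, hν g, hμ g]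

open Classical in
/-- The image under `f` of the uniform measure on `F`. -/
noncomputable def uniform {ι : Type*} (F : Finset ι) (hF : F.Nonempty) (f : ι → G) : ProbSpace G :=
  ofHasSum (fun g => ∑ i ∈ F, if g = f i then (F.card : ℝ)⁻¹ else 0)
    (fun g => Finset.sum_nonneg fun i _ => by split_ifs <;> positivity)
    (by
      have h := hasSum_sum (s := F) fun i _ => hasSum_ite_eq (f i) ((F.card : ℝ)⁻¹)
      rw [Finset.sum_const, nsmul_eq_mul,
        mul_inv_cancel₀ (by exact_mod_cast hF.card_pos.ne')] at h
      exact h)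

open Classical in
theorem uniform_apply {ι : Type*} (F : Finset ι) (hF : F.Nonempty) (f : ι → G) (g : G) :
    (uniform F hF f).1 g = ∑ i ∈ F, if g = f i then (F.card : ℝ)⁻¹ else 0 := rfl

theorem mean_uniform {ι : Type*} (F : Finset ι) (hF : F.Nonempty) (f : ι → G) (a : G → ℝ) :
    (uniform F hF f).mean a = (F.card : ℝ)⁻¹ * ∑ i ∈ F, a (f i) := by
  classical
  have h := hasSum_sum (s := F) fun i _ => hasSum_ite_eq (f i) ((F.card : ℝ)⁻¹ * a (f i))
  rw [mean, Finset.mul_sum, ← h.tsum_eq]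
  refine tsum_congr fun g => ?_
  rw [uniform_apply, Finset.sum_mul]
  refine Finset.sum_congr rfl fun i _ => ?_
  split_ifs with hg <;> simp [hg]

/-- The permutation `e` of the index set realizes inversion, so the sum for `g⁻¹` is a reindexing of
the sum for `g`. -/
theorem isSymmetric_uniform [Group G] {ι : Type*} (F : Finset ι) (hF : F.Nonempty) (f : ι → G)
    (e : ι ≃ ι) (he : ∀ i, e i ∈ F ↔ i ∈ F) (hf : ∀ i, f (e i) = (f i)⁻¹) :
    (uniform F hF f).IsSymmetric := fun g => by
  classical
  rw [uniform_apply, uniform_apply]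
  refine Finset.sum_equiv e (fun i => (he i).symm) fun i _ => ?_
  rw [hf, inv_eq_iff_eq_inv]

end ProbSpace

/-- An amenable subgroup carries finitely supported symmetric probability measures that are almost
invariant under left multiplication. -/
theorem IsAmenableGroup.exists_probSpace {G : Type u} [Group G] {H : Subgroup G}
    (hH : IsAmenableGroup H) {R : Set G} (hR : R.Finite) (hRH : R ⊆ H) {ε : ℝ} (hε : 0 < ε) :
    ∃ μ : ProbSpace G, μ.IsSymmetric ∧ ∀ h ∈ R, ∀ a : G → ℝ, (∀ g, a g ∈ Set.Icc (0 : ℝ) 1) →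
      |μ.mean a - μ.mean (fun g => a (h * g))| ≤ ε := by
  classical
  obtain ⟨F', hF', hFne, hF⟩ := hH ((↑) ⁻¹' R) ε (hR.preimage Subtype.val_injective.injOn) hε
  lift F' to Finset H using hF'
  have hFne : F'.Nonempty := hFne
  have hc : (0 : ℝ) < F'.card := by exact_mod_cast hFne.card_pos
  -- The law of `x y⁻¹` for independent uniform `x, y` in the Følner set: exchanging `x` and `y`
  -- inverts it, and for each fixed `y` almost invariance is inherited from `x`.
  refine ⟨ProbSpace.uniform (F' ×ˢ F') (hFne.product hFne) fun p => (p.1 : G) * (p.2 : G)⁻¹,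
    ProbSpace.isSymmetric_uniform _ _ _ (Equiv.prodComm _ _) ?_ ?_, fun h hh a ha => ?_⟩
  · simp [and_comm]
  · simp
  set k : H := ⟨h, hRH hh⟩
  have key : ∀ b : H → ℝ, (∀ x, b x ∈ Set.Icc (0 : ℝ) 1) →
      |∑ x ∈ F', b x - ∑ x ∈ F', b (k * x)| ≤ ε * F'.card := by
    intro b hb
    set E := F'.image (k * ·) with hE
    have hEc : E.card = F'.card := Finset.card_image_of_injective _ (mul_right_injective k)
    have h1 : ∑ x ∈ F', b (k * x) = ∑ x ∈ E, b x := by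
      rw [hE, Finset.sum_image (fun x _ y _ hxy => mul_right_injective k hxy)]
    have h2 : ∀ A B : Finset H, ∑ x ∈ A, b x ≤ ∑ x ∈ B, b x + (A \ B).card := by
      intro A B
      rw [← Finset.sum_inter_add_sum_sdiff A B b]
      refine add_le_add (Finset.sum_le_sum_of_subset_of_nonneg Finset.inter_subset_right
        fun x _ _ => (hb x).1) ?_
      exact (Finset.sum_le_card_nsmul _ _ 1 fun x _ => (hb x).2).trans (by simp)
    have h3 : ((E \ F').card : ℝ) ≤ ε * F'.card := by
      refine le_trans ?_ (Set.ncard_coe_finset F' ▸ hF.le)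
      rw [← Set.ncard_coe_finset]
      refine Nat.cast_le.2 (Set.ncard_le_ncard ?_ ?_)
      · intro x hx
        simp only [Finset.coe_sdiff, hE, Finset.coe_image] at hx
        obtain ⟨⟨y, hy, rfl⟩, hx⟩ := hx
        exact ⟨⟨k, hh, y, hy, rfl⟩, hx⟩
      · exact ((hR.preimage Subtype.val_injective.injOn).image2 _ F'.finite_toSet).sdiff
    -- The Følner condition bounds only `E \ F'`; equal cardinalities transfer the bound to `F' \
    -- E`.
    have h4 : (F' \ E).card = (E \ F').card := by
      have e1 := Finset.card_sdiff_add_card_inter F' E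
      have e2 := Finset.card_sdiff_add_card_inter E F'
      rw [Finset.inter_comm] at e2
      omega
    have h5 := h2 F' E
    have h6 := h2 E F'
    rw [h4] at h5
    rw [h1, abs_le]
    constructor <;> linarith
  rw [ProbSpace.mean_uniform, ProbSpace.mean_uniform, ← mul_sub, Finset.sum_product_right,
    Finset.sum_product_right, ← Finset.sum_sub_distrib, abs_mul, Finset.card_product]
  have h7 : |∑ y ∈ F', (∑ x ∈ F', a (x * (y : G)⁻¹) - ∑ x ∈ F', a (h * (x * (y : G)⁻¹)))| ≤
      F'.card * (ε * F'.card) := by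
    refine (Finset.abs_sum_le_sum_abs _ _).trans ?_
    refine (Finset.sum_le_card_nsmul _ _ (ε * F'.card) fun y _ => ?_).trans_eq (by simp)
    simpa [k, mul_assoc] using key (fun x => a (x * (y : G)⁻¹)) fun x => ha _
  rw [abs_of_nonneg (by positivity)]
  refine (mul_le_mul_of_nonneg_left h7 (by positivity)).trans_eq ?_
  push_cast
  field_simp

namespace ProbSpace

variable {G : Type u} [Group G]

/-! ### Weights selecting an element that barely moves the walk -/

open Classical in
/-- With `r g` and `q g` the probabilities that an increment `g` is accepted, respectively
passed over, this is the probability that the first accepted increment comes after at least `m`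
others and at a position `y` of the walk started at `z` with `σ y = s`. -/
noncomputable def swapWeight (r q : G → ℝ) (σ : G → G) (s : G) : ℕ → G → List G → ℝ
  | _, _, [] => 0
  | m, z, g :: l =>
    (if m = 0 ∧ σ z = s then r g else 0) + q g * swapWeight r q σ s (m - 1) (z * g) l

section

variable {r q : G → ℝ} {σ : G → G}

theorem swapWeight_nonneg (hr : ∀ g, 0 ≤ r g) (hq : ∀ g, 0 ≤ q g) (s : G) (m : ℕ) (z : G)
    (l : List G) : 0 ≤ swapWeight r q σ s m z l := by
  induction l generalizing m z with
  | nil => exact le_rfl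
  | cons g l ih =>
    refine add_nonneg ?_ (mul_nonneg (hq g) (ih _ _))
    split_ifs
    exacts [hr g, le_rfl]

theorem sum_swapWeight_cons {S : Finset G} (hσ : ∀ z, σ z ∈ S) (m : ℕ) (z g : G) (l : List G) :
    ∑ s ∈ S, swapWeight r q σ s m z (g :: l) =
      (if m = 0 then r g else 0) + q g * ∑ s ∈ S, swapWeight r q σ s (m - 1) (z * g) l := by
  classical
  simp only [swapWeight]
  rw [Finset.sum_add_distrib, Finset.mul_sum]
  congr 1
  by_cases hm : m = 0 <;> simp [hm, hσ z]

theorem sum_swapWeight_le_one {S : Finset G} (hσ : ∀ z, σ z ∈ S) (hr : ∀ g, 0 ≤ r g)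
    (hq : ∀ g, 0 ≤ q g) (hrq : ∀ g, r g + q g ≤ 1) (m : ℕ) (z : G) (l : List G) :
    ∑ s ∈ S, swapWeight r q σ s m z l ≤ 1 := by
  induction l generalizing m z with
  | nil => simp [swapWeight]
  | cons g l ih =>
    rw [sum_swapWeight_cons hσ]
    have h1 : (if m = 0 then r g else 0) ≤ r g := by split_ifs; exacts [le_rfl, hr g]
    have h2 := mul_le_mul_of_nonneg_left (ih (m - 1) (z * g)) (hq g)
    linarith [hrq g]

/-- Summed over `s`, the weights give the probability that the first acceptance falls among steps
`m, …, n - 1`. If passing over had probability exactly `1 - δ`, this would be the geometric sum `(1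
- δ) ^ m - (1 - δ) ^ n`; each step loses at most `τ` to increments neither accepted nor passed over.
-/
theorem le_expect_sum_swapWeight (ν : ProbSpace G) {S : Finset G} (hσ : ∀ z, σ z ∈ S)
    (hr : ∀ g, 0 ≤ r g) (hq : ∀ g, 0 ≤ q g) (hrq : ∀ g, r g + q g ≤ 1) {δ τ : ℝ} (hδ0 : 0 ≤ δ)
    (hδ1 : δ ≤ 1) (hτ : 0 ≤ τ) (hνr : ν.mean r = δ) (hνq : ν.mean q ≤ 1 - δ)
    (hνq' : 1 - δ - τ ≤ ν.mean q) (m n : ℕ) (z : G) :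
    (1 - δ) ^ m - (1 - δ) ^ n - n * τ ≤
      ν.expect n fun l => ∑ s ∈ S, swapWeight r q σ s m z l := by
  induction n generalizing m z with
  | zero =>
    have : (1 - δ) ^ m ≤ 1 := pow_le_one₀ (by linarith) (by linarith)
    simpa [expect, swapWeight] using this
  | succ n ih =>
    have hW : ∀ m z l, |∑ s ∈ S, swapWeight r q σ s m z l| ≤ 1 := fun m z l => by
      rw [abs_of_nonneg (Finset.sum_nonneg fun s _ => swapWeight_nonneg hr hq s m z l)]
      exact sum_swapWeight_le_one hσ hr hq hrq m z l
    have hr1 : ∀ g, |r g| ≤ 1 := fun g => by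
      rw [abs_of_nonneg (hr g)]; linarith [hrq g, hq g]
    have hq1 : ∀ g, |q g| ≤ 1 := fun g => by
      rw [abs_of_nonneg (hq g)]; linarith [hrq g, hr g]
    have hc : ∀ g, |if m = 0 then r g else 0| ≤ 1 := fun g => by
      split_ifs
      exacts [hr1 g, by simp]
    have hqW : ∀ g l, |q g * ∑ s ∈ S, swapWeight r q σ s (m - 1) (z * g) l| ≤ 1 := fun g l => by
      rw [abs_mul]
      exact mul_le_one₀ (hq1 g) (abs_nonneg _) (hW _ _ _)
    set L := (1 - δ) ^ (m - 1) - (1 - δ) ^ n - n * τ with hL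
    have hL1 : L ≤ 1 := by
      have h1 : (1 - δ) ^ (m - 1) ≤ 1 := pow_le_one₀ (by linarith) (by linarith)
      have h2 : 0 ≤ (1 - δ) ^ n := pow_nonneg (by linarith) _
      have h3 : 0 ≤ n * τ := by positivity
      linarith
    have hqL : ∀ g, |L * q g| ≤ |L| := fun g => by
      rw [abs_mul]; exact mul_le_of_le_one_right (abs_nonneg _) (hq1 g)
    have h1 : ν.mean (fun g => (if m = 0 then r g else 0) + L * q g) ≤
        ν.expect (n + 1) fun l => ∑ s ∈ S, swapWeight r q σ s m z l := by
      refine ν.mean_mono (fun g => (abs_add_le _ _).trans (add_le_add (hc g) (hqL g)))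
        (fun g => ν.abs_expect_le n fun l => hW m z _) fun g => ?_
      simp only [sum_swapWeight_cons hσ]
      rw [ν.expect_add n (fun _ => hc g) (hqW g), expect_const, expect_const_mul, mul_comm L]
      have := mul_le_mul_of_nonneg_left (ih (m - 1) (z * g)) (hq g)
      linarith
    refine le_trans ?_ h1
    rw [ν.mean_add hc hqL, mean_const_mul]
    -- The defect `1 - δ - ν.mean q` lies in `[0, τ]`, so `L ≤ 1` suffices, even when `L` is
    -- negative.
    have h2 : (1 - δ) * L - τ ≤ L * ν.mean q := by
      have := mul_le_mul_of_nonneg_right hL1 (sub_nonneg.2 hνq)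
      nlinarith
    have h3 : (1 - δ) * (n * τ) ≤ n * τ :=
      mul_le_of_le_one_left (by positivity) (by linarith)
    -- For `m = 0` truncated subtraction keeps `m - 1 = 0`: acceptance stays allowed, and the new
    -- term `δ` completes `1 - δ` to `1`.
    cases m with
    | zero =>
      simp only [if_true, pow_zero, Nat.zero_sub, hνr] at *
      push_cast
      rw [pow_succ]
      nlinarith
    | succ m =>
      simp only [Nat.succ_ne_zero, if_false, mean_const, Nat.add_sub_cancel] at *
      push_cast
      rw [pow_succ, pow_succ]
      nlinarith

/-- Condition on the next increment. Accepted increments have law `δ μ`, and almost invariance under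
`z⁻¹ s z` bounds the effect of the swap by `δ ε`; increments passed over have mass at most `1 - δ`
and error at most `ε` by induction. The sum is again `ε`, so errors do not accumulate. The set `K k`
holds the positions reachable by passing over `k` increments; almost invariance is needed only
there. -/
theorem abs_expect_swapWeight_le (ν μ : ProbSpace G) (s : G) (hr : ∀ g, 0 ≤ r g)
    (hq : ∀ g, 0 ≤ q g) (hrq : ∀ g, r g + q g ≤ 1) {δ ε : ℝ} (hδ0 : 0 ≤ δ) (hε : 0 ≤ ε)
    (hνr : ∀ g, ν.1 g * r g = δ * μ.1 g) (hνq : ν.mean q ≤ 1 - δ) {N : ℕ} {K : ℕ → Set G}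
    (hK : ∀ k, ∀ z ∈ K k, ∀ g, q g ≠ 0 → z * g ∈ K (k + 1))
    (hinv : ∀ k < N, ∀ z ∈ K k, σ z = s → ∀ a : G → ℝ, (∀ g, a g ∈ Set.Icc (0 : ℝ) 1) →
      |μ.mean a - μ.mean (fun g => a (z⁻¹ * s * z * g))| ≤ ε) (n : ℕ) :
    ∀ (m k : ℕ) (z : G) (φ : List G → G → ℝ), k + n ≤ N → z ∈ K k →
      (∀ l y, φ l y ∈ Set.Icc (0 : ℝ) 1) →
      |ν.expect n fun l => swapWeight r q σ s m z l *
        (φ (l.take m) (z * l.prod) - φ (l.take m) (s * (z * l.prod)))| ≤ ε := by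
  classical
  have hr1 : ∀ g, |r g| ≤ 1 := fun g => by
    rw [abs_of_nonneg (hr g)]; linarith [hrq g, hq g]
  have hq1 : ∀ g, |q g| ≤ 1 := fun g => by
    rw [abs_of_nonneg (hq g)]; linarith [hrq g, hr g]
  have hW1 : ∀ m z l, swapWeight r q σ s m z l ≤ 1 := by
    intro m z l
    induction l generalizing m z with
    | nil => simp [swapWeight]
    | cons g l ih =>
      have h1 : (if m = 0 ∧ σ z = s then r g else 0) ≤ r g := by split_ifs; exacts [le_rfl, hr g]
      have h2 := mul_le_mul_of_nonneg_left (ih (m - 1) (z * g)) (hq g)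
      simp only [swapWeight]
      linarith [hrq g]
  have hsub : ∀ {x y : ℝ}, x ∈ Set.Icc (0 : ℝ) 1 → y ∈ Set.Icc (0 : ℝ) 1 → |x - y| ≤ 1 :=
    fun hx hy => abs_le.2 ⟨by linarith [hx.1, hy.2], by linarith [hx.2, hy.1]⟩
  have hWsub : ∀ (m : ℕ) (z : G) (l : List G) {x y : ℝ}, x ∈ Set.Icc (0 : ℝ) 1 →
      y ∈ Set.Icc (0 : ℝ) 1 → |swapWeight r q σ s m z l * (x - y)| ≤ 1 := fun m z l x y hx hy => by
    rw [abs_mul, abs_of_nonneg (swapWeight_nonneg hr hq s m z l)]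
    exact mul_le_one₀ (hW1 m z l) (abs_nonneg _) (hsub hx hy)
  have hpass : ∀ B : G → ℝ, (∀ g, q g ≠ 0 → |B g| ≤ ε) →
      |ν.mean fun g => q g * B g| ≤ (1 - δ) * ε := by
    intro B hB
    have h := ν.abs_mean_le (a := fun g => q g * B g) (b := fun g => ε * q g) (D := ε)
      (fun g => by
        rw [abs_mul, abs_of_nonneg hε]; exact mul_le_of_le_one_right hε (hq1 g))
      (fun g => by
        by_cases h0 : q g = 0
        · simp [h0]
        · rw [abs_mul, abs_of_nonneg (hq g), mul_comm]
          exact mul_le_mul_of_nonneg_right (hB g h0) (hq g))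
    rw [mean_const_mul, mul_comm] at h
    exact h.trans (mul_le_mul_of_nonneg_right hνq hε)
  induction n with
  | zero => intro m k z φ _ _ _; simpa [expect, swapWeight] using hε
  | succ n ih =>
    intro m k z φ hkn hz hφ
    cases m with
    | succ m =>
      -- No acceptance is allowed yet: the increment is moved into the first argument of `φ`, which
      -- the swap leaves alone.
      have h := hpass (fun g => ν.expect n fun l => swapWeight r q σ s m (z * g) l *
        (φ (g :: l.take m) (z * g * l.prod) - φ (g :: l.take m) (s * (z * g * l.prod))))
        fun g hg => ih m (k + 1) (z * g) (fun l => φ (g :: l)) (by omega) (hK k z hz g hg)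
          fun l y => hφ _ _
      refine le_trans (le_of_eq ?_) (h.trans (by nlinarith))
      simp only [expect, swapWeight, ← expect_const_mul]
      simp [mul_assoc]
    | zero =>
      set B : G → ℝ := fun g => ν.expect n fun l => swapWeight r q σ s 0 (z * g) l *
        (φ [] (z * g * l.prod) - φ [] (s * (z * g * l.prod))) with hBdef
      have hB1 : ∀ g, |B g| ≤ 1 := fun g =>
        ν.abs_expect_le n fun l => hWsub _ _ _ (hφ _ _) (hφ _ _)
      have hB := hpass B fun g hg => ih 0 (k + 1) (z * g) φ (by omega) (hK k z hz g hg) hφ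
      set c : G → ℝ := fun g => if σ z = s then r g else 0 with hc
      have hc1 : ∀ g, |c g| ≤ 1 := fun g => by
        simp only [hc]
        split_ifs
        exacts [hr1 g, by simp]
      -- The expected value of `φ` as a function of the accepted increment; multiplying that
      -- increment on the left by `z⁻¹ s z` multiplies the endpoint by `s`.
      set a : G → ℝ := fun g => ν.expect n fun l => φ [] (z * (g * l.prod)) with ha
      have hφ1 : ∀ l y, |φ l y| ≤ 1 := fun l y => by
        rw [abs_of_nonneg (hφ l y).1]; exact (hφ l y).2
      have ha1 : ∀ g, |a g| ≤ 1 := fun g => ν.abs_expect_le n fun l => hφ1 _ _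
      have ha01 : ∀ g, a g ∈ Set.Icc (0 : ℝ) 1 := fun g =>
        ⟨ν.expect_nonneg n fun l => (hφ _ _).1, (le_abs_self _).trans (ha1 g)⟩
      set A : G → ℝ := fun g => a g - a (z⁻¹ * s * z * g) with hA
      have hA1 : ∀ g, |A g| ≤ 1 := fun g => hsub (ha01 _) (ha01 _)
      have hexp : (ν.expect (n + 1) fun l => swapWeight r q σ s 0 z l *
          (φ (l.take 0) (z * l.prod) - φ (l.take 0) (s * (z * l.prod)))) =
          ν.mean (fun g => c g * A g) + ν.mean fun g => q g * B g := by
        rw [← ν.mean_add (C := 1) (D := 1)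
          (fun g => by rw [abs_mul]; exact mul_le_one₀ (hc1 g) (abs_nonneg _) (hA1 g))
          (fun g => by rw [abs_mul]; exact mul_le_one₀ (hq1 g) (abs_nonneg _) (hB1 g))]
        simp only [expect]
        congr 1
        funext g
        have hA' : A g = ν.expect n fun l => φ [] (z * (g * l.prod)) -
            φ [] (s * (z * (g * l.prod))) := by
          rw [ν.expect_sub n (fun l => hφ1 _ _) (fun l => hφ1 _ _)]
          simp [hA, ha, mul_assoc]
        rw [hA', hBdef, ← expect_const_mul, ← expect_const_mul,
          ← ν.expect_add n (C := 1) (D := 1)]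
        · congr 1
          funext l
          simp only [swapWeight, List.take_zero, List.prod_cons, true_and, Nat.zero_sub, hc,
            mul_assoc]
          ring
        · intro l
          rw [abs_mul]
          exact mul_le_one₀ (hc1 g) (abs_nonneg _) (hsub (hφ _ _) (hφ _ _))
        · intro l
          rw [abs_mul]
          exact mul_le_one₀ (hq1 g) (abs_nonneg _) (hWsub _ _ _ (hφ _ _) (hφ _ _))
      have hcA : |ν.mean (fun g => c g * A g)| ≤ δ * ε := by
        by_cases hs : σ z = s
        · have e : ν.mean (fun g => c g * A g) = δ * μ.mean A := by
            rw [mean, mean, ← tsum_mul_left]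
            refine tsum_congr fun g => ?_
            simp only [hc, hs, if_true]
            rw [← mul_assoc, hνr, mul_assoc]
          rw [e, abs_mul, abs_of_nonneg hδ0, hA, μ.mean_sub ha1 fun g => ha1 _]
          exact mul_le_mul_of_nonneg_left (hinv k (by omega) z hz hs a ha01) hδ0
        · simp only [hc, hs, if_false, zero_mul, mean_const, abs_zero]
          positivity
      rw [hexp]
      refine (abs_add_le _ _).trans ((add_le_add hcA hB).trans (le_of_eq ?_))
      ring

end

end ProbSpace

namespace ProbSpace

variable {G : Type u} [Group G]

/-! ### Generic measures -/

/-- With probability at least `1 - ε`, after `N ≥ M` steps of the random walk one can select an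
element `s ∈ S` such that replacing the position `y` by `s y` hardly affects the joint distribution
of the first `M` increments and the position. -/
def IsSwapping (ν : ProbSpace G) (S : Finset G) (M : ℕ) (ε : ℝ) : Prop :=
  ∃ N, M ≤ N ∧ ∃ w : G → List G → ℝ, (∀ s l, 0 ≤ w s l) ∧ (∀ l, ∑ s ∈ S, w s l ≤ 1) ∧
    1 - ε ≤ ν.expect N (fun l => ∑ s ∈ S, w s l) ∧
    ∀ s ∈ S, ∀ φ : List G → G → ℝ, (∀ l y, φ l y ∈ Set.Icc (0 : ℝ) 1) →
      |ν.expect N fun l => w s l * (φ (l.take M) l.prod - φ (l.take M) (s * l.prod))| ≤ ε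

/-- The same `N` and `w` work near `μ`: every expectation involved is of a function of `N`
increments bounded by `1`, hence changes by at most `N * dist ν μ`. -/
theorem IsSwapping.exists_ball {μ : ProbSpace G} {S : Finset G} {M : ℕ} {ε : ℝ}
    (h : μ.IsSwapping S M ε) (hε : 0 < ε) :
    ∃ ρ > 0, ∀ ν : ProbSpace G, dist ν μ < ρ → ν.IsSwapping S M (2 * ε) := by
  obtain ⟨N, hMN, w, hw0, hw1, hmass, hswap⟩ := h
  refine ⟨ε / (N + 1), by positivity, fun ν hν => ⟨N, hMN, w, hw0, hw1, ?_, fun s hs φ hφ => ?_⟩⟩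
  all_goals
    have hNd : N * (1 * dist ν μ) ≤ ε := by
      rw [lt_div_iff₀ (by positivity)] at hν
      nlinarith [dist_nonneg (x := ν) (y := μ)]
  · have h1 := (abs_expect_sub_expect_le ν μ (C := 1) N (φ := fun l => ∑ s ∈ S, w s l) fun l => by
      rw [abs_of_nonneg (Finset.sum_nonneg fun s _ => hw0 s l)]; exact hw1 l).trans hNd
    linarith [(abs_le.1 h1).1]
  · have hws : ∀ l, w s l ≤ 1 := fun l =>
      (Finset.single_le_sum (f := fun s => w s l) (fun s _ => hw0 s l) hs).trans (hw1 l)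
    have h1 := (abs_expect_sub_expect_le ν μ (C := 1) N
      (φ := fun l => w s l * (φ (l.take M) l.prod - φ (l.take M) (s * l.prod))) fun l => by
        rw [abs_mul, abs_of_nonneg (hw0 s l)]
        refine mul_le_one₀ (hws l) (abs_nonneg _) (abs_le.2 ⟨?_, ?_⟩) <;>
        linarith [(hφ (l.take M) l.prod).1, (hφ (l.take M) l.prod).2,
          (hφ (l.take M) (s * l.prod)).1, (hφ (l.take M) (s * l.prod)).2]).trans hNd
    have h2 := hswap s hs φ hφ
    rw [abs_le] at h1 h2 ⊢
    constructor <;> linarith [h1.1, h1.2, h2.1, h2.2]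

/-- Products of `k` elements of `T`. -/
def productSet (T : Set G) : ℕ → Set G
  | 0 => {1}
  | k + 1 => Set.image2 (· * ·) (productSet T k) T

theorem finite_productSet {T : Set G} (hT : T.Finite) (k : ℕ) : (productSet T k).Finite := by
  induction k with
  | zero => exact Set.finite_singleton 1
  | succ k ih => exact ih.image2 _ hT

open Classical in
-- The missing probability has three parts, each at most `ε / 3`: acceptance before step `M` (at
-- most `M δ`), no acceptance in `N` steps (`(1 - δ) ^ N`), and truncation to a finite set `T` (at
-- most `N τ`).
theorem exists_isSwapping_mix (ν : ProbSpace G) {S : Finset G} (hvis : AmenablyVisible S) (M : ℕ)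
    {ε δ : ℝ} (hε : 0 < ε) (hδ0 : 0 < δ) (hδ1 : δ ≤ 1) (hMδ : M * δ ≤ ε / 3) :
    ∃ μ : ProbSpace G, μ.IsSymmetric ∧ (mix δ hδ0.le hδ1 ν μ).IsSwapping S M ε := by
  obtain ⟨H, hH, hS⟩ := hvis
  -- Visibility is applied to `γ = z⁻¹`, so that the conjugate `z⁻¹ * σ z * z` lies in `H`.
  choose σ hσ hσ' using fun z : G => hS z⁻¹
  have hσH : ∀ z, z⁻¹ * σ z * z ∈ H := fun z => by
    obtain ⟨h, hh, e⟩ := hσ' z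
    rw [e]
    simpa [mul_assoc] using hh
  obtain ⟨N₀, hN₀⟩ := exists_pow_lt_of_lt_one (by positivity : 0 < ε / 3) (by linarith : 1 - δ < 1)
  set N := max M N₀ with hN
  have hNε : (1 - δ) ^ N ≤ ε / 3 :=
    (pow_le_pow_of_le_one (by linarith) (by linarith) (le_max_right _ _)).trans hN₀.le
  set τ : ℝ := ε / (3 * (N + 1)) with hτ
  have hτ0 : 0 < τ := by positivity
  -- Passing over only increments from a finite set leaves finitely many positions before
  -- acceptance, hence finitely many elements of `H` under which `μ` must be almost invariant.
  obtain ⟨T, hT⟩ := (ν.2.2.eventually (lt_mem_nhds (by linarith : 1 - τ < 1))).exists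
  have hT1 : ∑ g ∈ T, ν.1 g ≤ 1 := sum_le_hasSum T (fun g _ => ν.2.1 g) ν.2.2
  set K := productSet (T : Set G) with hK
  obtain ⟨μ, hμ, hinv⟩ := hH.exists_probSpace
    (R := ⋃ k ∈ Finset.range N, (fun z => z⁻¹ * σ z * z) '' K k)
    ((Finset.range N).finite_toSet.biUnion fun k _ =>
      (finite_productSet T.finite_toSet k).image _)
    (by
      simp only [Set.iUnion_subset_iff, Set.image_subset_iff]
      exact fun k _ z _ => hσH z) hε
  refine ⟨μ, hμ, ?_⟩
  set ν' := mix δ hδ0.le hδ1 ν μ with hν'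
  have hap : ∀ g, ν'.1 g = (1 - δ) * ν.1 g + δ * μ.1 g := mix_apply δ hδ0.le hδ1 ν μ
  have hν0 : ∀ g, 0 ≤ (1 - δ) * ν.1 g := fun g => mul_nonneg (by linarith) (ν.2.1 g)
  have hμ0 : ∀ g, 0 ≤ δ * μ.1 g := fun g => mul_nonneg hδ0.le (μ.2.1 g)
  -- The conditional probability that an increment `g` of the mixture was drawn from `μ`. Where
  -- `ν'.1 g = 0` the division yields `0`, consistently with `δ * μ.1 g = 0`.
  set r : G → ℝ := fun g => δ * μ.1 g / ν'.1 g with hr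
  have hνr : ∀ g, ν'.1 g * r g = δ * μ.1 g := by
    intro g
    by_cases h0 : ν'.1 g = 0
    · rw [h0, zero_mul]
      rw [hap] at h0
      linarith [hν0 g, hμ0 g]
    · exact mul_div_cancel₀ _ h0
  have hr0 : ∀ g, 0 ≤ r g := fun g => div_nonneg (hμ0 g) (ν'.2.1 g)
  have hr1 : ∀ g, r g ≤ 1 := fun g =>
    div_le_one_of_le₀ (by rw [hap]; linarith [hν0 g]) (ν'.2.1 g)
  set q : G → ℝ := fun g => if g ∈ T then 1 - r g else 0 with hq
  have hq0 : ∀ g, 0 ≤ q g := fun g => by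
    simp only [hq]; split_ifs
    exacts [by linarith [hr1 g], le_rfl]
  have hrq : ∀ g, r g + q g ≤ 1 := fun g => by
    simp only [hq]; split_ifs
    exacts [by linarith, by linarith [hr1 g]]
  have hmr : ν'.mean r = δ := by
    rw [mean, tsum_congr hνr, tsum_mul_left, μ.2.2.tsum_eq, mul_one]
  have hmq : ν'.mean q = (1 - δ) * ∑ g ∈ T, ν.1 g := by
    rw [mean, tsum_eq_sum (s := T) fun g hg => by simp [hq, hg], Finset.mul_sum]
    refine Finset.sum_congr rfl fun g hg => ?_
    simp only [hq, hg, if_true]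
    rw [mul_sub, hνr, hap]
    ring
  have hmq1 : ν'.mean q ≤ 1 - δ := hmq ▸ mul_le_of_le_one_right (by linarith) hT1
  have hmq2 : 1 - δ - τ ≤ ν'.mean q := by
    rw [hmq]
    nlinarith
  refine ⟨N, le_max_left _ _, fun s => swapWeight r q σ s M 1,
    fun s l => swapWeight_nonneg hr0 hq0 s M 1 l,
    fun l => sum_swapWeight_le_one hσ hr0 hq0 hrq M 1 l, ?_, fun s _ φ hφ => ?_⟩
  · refine le_trans ?_ (ν'.le_expect_sum_swapWeight hσ hr0 hq0 hrq hδ0.le hδ1 hτ0.le hmr hmq1 hmq2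
      M N 1)
    have h1 : 1 - M * δ ≤ (1 - δ) ^ M := by
      have := one_add_mul_le_pow (by linarith : (-2 : ℝ) ≤ -δ) M
      simpa [sub_eq_add_neg] using this
    have h2 : N * τ ≤ ε / 3 := by
      rw [hτ, mul_div_assoc', div_le_div_iff₀ (by positivity) (by norm_num)]
      nlinarith
    linarith
  · have h := ν'.abs_expect_swapWeight_le (σ := σ) μ s hr0 hq0 hrq hδ0.le hε.le hνr hmq1 (N := N) (K := K)
      (fun k z hz g hg => ⟨z, hz, g, by
        by_contra hgT
        exact hg (if_neg hgT), rfl⟩)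
      (fun k hk z hz hs a ha => hinv _ (by
        simp only [Set.mem_iUnion]
        exact ⟨k, Finset.mem_range.2 hk, z, hz, by simp only [hs]⟩) a ha)
      N M 0 1 φ (by omega) (Set.mem_singleton 1) hφ
    simpa using h

theorem isNondegenerate_of_full_support {ν : ProbSpace G} (hν : ∀ g, ν.1 g ≠ 0) :
    ν.IsNondegenerate := by
  rw [IsNondegenerate, Set.eq_univ_of_forall (s := {g : G | ν.1 g ≠ 0}) hν,
    Subsemigroup.closure_univ]

/-! ### Genericity by small mixtures -/

section

variable {Y : Type*} [PseudoMetricSpace Y] {f : Y → ProbSpace G}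

/-- Every point has arbitrarily close mixtures with a whole ball in `Q`, so `Q` contains a dense
open set. The isometry `f` treats the full space and the symmetric subspace together, which is why
only symmetric `μ` are mixed in. -/
theorem eventually_residual_of_mix (hf : Isometry f)
    (hmix : ∀ (y : Y) (δ : ℝ) (h0 : 0 ≤ δ) (h1 : δ ≤ 1) (μ : ProbSpace G), μ.IsSymmetric →
      ∃ y', f y' = mix δ h0 h1 (f y) μ) {Q : ProbSpace G → Prop}
    (hQ : ∀ (ν : ProbSpace G) (η : ℝ), 0 < η → ∃ (δ : ℝ) (h0 : 0 ≤ δ) (h1 : δ ≤ 1)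
      (μ : ProbSpace G), δ ≤ η ∧ μ.IsSymmetric ∧
        ∃ ρ > 0, ∀ ν', dist ν' (mix δ h0 h1 ν μ) < ρ → Q ν') :
    ∀ᶠ y in residual Y, Q (f y) := by
  have hd : Dense (interior {y | Q (f y)}) := by
    refine Metric.dense_iff.2 fun y η hη => ?_
    obtain ⟨δ, h0, h1, μ, hδ, hμ, ρ, hρ, hball⟩ := hQ (f y) (η / 3) (by positivity)
    obtain ⟨y', hy'⟩ := hmix y δ h0 h1 μ hμ
    refine ⟨y', ?_, ?_⟩
    · rw [Metric.mem_ball, ← hf.dist_eq, hy']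
      exact (dist_mix_le δ h0 h1 _ _).trans_lt (by linarith)
    · refine mem_interior.2 ⟨Metric.ball y' ρ, fun z hz => hball _ ?_, Metric.isOpen_ball,
        Metric.mem_ball_self hρ⟩
      rwa [← hy', hf.dist_eq]
  exact mem_of_superset (residual_of_dense_open isOpen_interior hd) interior_subset

theorem eventually_residual_isSwapping [Countable G] (hf : Isometry f)
    (hmix : ∀ (y : Y) (δ : ℝ) (h0 : 0 ≤ δ) (h1 : δ ≤ 1) (μ : ProbSpace G), μ.IsSymmetric →
      ∃ y', f y' = mix δ h0 h1 (f y) μ) {S : Finset G} (hvis : AmenablyVisible S) :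
    ∀ᶠ y in residual Y, (∀ g, (f y).1 g ≠ 0) ∧
      ∀ M : ℕ, ∀ ε : ℝ, 0 < ε → ∃ ε' ≤ ε, (f y).IsSwapping S M ε' := by
  refine Eventually.and (eventually_countable_forall.2 fun g => ?_)
    (eventually_countable_forall.2 fun M => ?_)
  · refine eventually_residual_of_mix (Q := fun ν => ν.1 g ≠ 0) hf hmix fun ν η hη => ?_
    -- Mixing in mass at both `g` and `g⁻¹` keeps symmetry. The mixture has mass at least `δ * μ.1
    -- g` at `g`, so no measure closer than that vanishes at `g`.
    have hδ0 : 0 < min η 1 := by positivity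
    set μ := uniform (Finset.univ : Finset Bool) Finset.univ_nonempty
      (fun b => if b then g else g⁻¹) with hμ
    have hμg : 0 < μ.1 g := by
      classical
      rw [hμ, uniform_apply]
      refine Finset.sum_pos' (fun i _ => ite_nonneg (by positivity) le_rfl)
        ⟨true, Finset.mem_univ _, by
          rw [if_pos (if_pos rfl).symm]; simp⟩
    refine ⟨min η 1, hδ0.le, min_le_right _ _, μ, min_le_left _ _,
      isSymmetric_uniform _ _ _ Equiv.boolNot
        (fun i => by simp only [Finset.mem_univ]) (fun i => by cases i <;> simp), _, mul_pos hδ0 hμg,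
      fun ν' h h0 => ?_⟩
    have h1 := abs_apply_sub_le_dist ν' (mix (min η 1) hδ0.le (min_le_right _ _) ν μ) g
    rw [h0, mix_apply, zero_sub, abs_neg] at h1
    have h2 := mul_nonneg (sub_nonneg.2 (min_le_right η 1)) (ν.2.1 g)
    linarith [le_abs_self ((1 - min η 1) * ν.1 g + min η 1 * μ.1 g)]
  · have h : ∀ᶠ y in residual Y, ∀ k : ℕ, (f y).IsSwapping S M (2 * (1 / (k + 1))) := by
      refine eventually_countable_forall.2 fun k => ?_
      refine eventually_residual_of_mix (Q := fun ν => ν.IsSwapping S M (2 * (1 / (k + 1)))) hf hmix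
        fun ν η hη => ?_
      have hε : (0 : ℝ) < 1 / (k + 1) := by positivity
      set ε : ℝ := 1 / (k + 1)
      set δ : ℝ := min η (min 1 (ε / (3 * (M + 1)))) with hδ
      have hδ0 : 0 < δ := by positivity
      have hδ1 : δ ≤ 1 := (min_le_right _ _).trans (min_le_left _ _)
      have hMδ : M * δ ≤ ε / 3 := by
        have h1 : δ ≤ ε / (3 * (M + 1)) := (min_le_right _ _).trans (min_le_right _ _)
        rw [le_div_iff₀ (by positivity)] at h1
        nlinarith
      obtain ⟨μ, hμ, hsw⟩ := ν.exists_isSwapping_mix hvis M hε hδ0 hδ1 hMδ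
      exact ⟨δ, hδ0.le, hδ1, μ, min_le_left _ _, hμ, hsw.exists_ball hε⟩
    filter_upwards [h] with y hy ε hε
    obtain ⟨k, hk⟩ := exists_nat_one_div_lt (half_pos hε)
    exact ⟨_, by linarith, hy k⟩

end

end ProbSpace

/-! ### The random walk after finitely many steps -/

namespace RandomWalk

variable {G : Type u}

/-- The sequence that starts with the entries of a list. -/
def appendSeq : List G → (ℕ → G) → ℕ → G
  | [], x => x
  | g :: l, x => consSeq (g, appendSeq l x)

/-- The list of the first `n` entries of a sequence. -/
def takeSeq (n : ℕ) (x : ℕ → G) : List G := List.ofFn fun i : Fin n => x i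

theorem takeSeq_appendSeq (l : List G) (x : ℕ → G) : takeSeq l.length (appendSeq l x) = l := by
  induction l with
  | nil => simp [takeSeq]
  | cons g l ih =>
    simp only [takeSeq, List.length_cons, List.ofFn_succ] at ih ⊢
    exact congrArg (g :: ·) ih

theorem appendSeq_take_apply (l : List G) (x y : ℕ → G) {M : ℕ} (hM : M ≤ l.length) {i : ℕ}
    (hi : i < M) : appendSeq (l.take M) x i = appendSeq l y i := by
  induction l generalizing M i with
  | nil => simp at hM; omega
  | cons g l ih =>
    obtain ⟨M, rfl⟩ : ∃ k, M = k + 1 := ⟨M - 1, by omega⟩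
    cases i with
    | zero => rfl
    | succ i => exact ih (by simpa using hM) (by omega)

theorem positions_consSeq_succ [Group G] (g : G) (x : ℕ → G) (n : ℕ) :
    positions (consSeq (g, x)) (n + 1) = g * positions x n := by
  induction n with
  | zero => rfl
  | succ n ih =>
    rw [positions, ih, positions, mul_assoc]
    rfl

/-- Once the list is spent, the walk is a fresh walk translated by `l.prod`. No index shift occurs,
because entry `0` of `positions` is already the first increment. -/
theorem positions_appendSeq [Group G] (l : List G) (x : ℕ → G) (i : ℕ) :
    positions (appendSeq l x) (l.length + i) = l.prod * positions x i := by
  induction l with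
  | nil => simp [appendSeq]
  | cons g l ih =>
    rw [appendSeq, List.length_cons, Nat.add_right_comm, positions_consSeq_succ, ih,
      List.prod_cons, mul_assoc]

section

variable [MeasurableSpace G]

theorem measurable_comp_takeSeq [Countable G] [DiscreteMeasurableSpace G] (n : ℕ)
    (w : List G → ℝ) : Measurable fun x => w (takeSeq n x) :=
  (Measurable.of_discrete (f := fun v : Fin n → G => w (List.ofFn v))).comp
    (measurable_pi_lambda _ fun i => measurable_pi_apply (i : ℕ))

/-- A set in the `σ`-algebra of the coordinates with index at least `n` does not depend on the
coordinates before `n`. -/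
theorem exists_preimage_of_fromTime {n : ℕ} {A : Set (ℕ → G)}
    (hA : MeasurableSet[fromTime G n] A) :
    ∃ B : Set (ℕ → G), MeasurableSet B ∧ (fun (ω : ℕ → G) i => ω (n + i)) ⁻¹' B = A := by
  have h : fromTime G n ≤ MeasurableSpace.comap (fun (ω : ℕ → G) i => ω (n + i))
      MeasurableSpace.pi := by
    refine iSup₂_le fun i hi => ?_
    rw [← measurable_iff_comap_le]
    have e : (fun ω : ℕ → G => ω i) = (fun ω : ℕ → G => ω (i - n)) ∘
        fun (ω : ℕ → G) j => ω (n + j) := by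
      funext ω
      simp [Nat.add_sub_cancel' hi]
    rw [e]
    exact (measurable_pi_apply (i - n)).comp (comap_measurable _)
  exact h A hA

/-- Cylinders over finitely many coordinates form an algebra generating the product `σ`-algebra, so
they are dense in measure. -/
theorem exists_approx_of_finitely_many_coordinates (P : Measure (ℕ → G)) [IsFiniteMeasure P]
    {A : Set (ℕ → G)} (hA : MeasurableSet A) {ε : ℝ} (hε : 0 < ε) :
    ∃ (M : ℕ) (D : Set (ℕ → G)), MeasurableSet D ∧
      (∀ x y : ℕ → G, (∀ i < M, x i = y i) → (x ∈ D ↔ y ∈ D)) ∧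
      P (symmDiff A D) < ENNReal.ofReal ε := by
  obtain ⟨D, hD, hAD⟩ := (Measure.MeasureDense.of_generateFrom_isSetAlgebra_finite P
    (isSetAlgebra_measurableCylinders (α := fun _ : ℕ => G))
    generateFrom_measurableCylinders.symm).approx A hA (measure_ne_top _ _) ε hε
  obtain ⟨s, E, hE, rfl⟩ := (mem_measurableCylinders D).1 hD
  refine ⟨s.sup id + 1, _, hE.cylinder s, fun x y hxy => ?_, hAD⟩
  have : s.restrict x = s.restrict y := funext fun i =>
    hxy i (Nat.lt_succ_of_le (Finset.le_sup (f := id) i.2))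
  rw [mem_cylinder, mem_cylinder, this]

theorem integrable_of_abs_le {X : Type*} [MeasurableSpace X] {P : Measure X} [IsFiniteMeasure P]
    {a : X → ℝ} (ha : Measurable a) {C : ℝ} (hC : ∀ x, |a x| ≤ C) : Integrable a P :=
  Integrable.of_bound ha.aestronglyMeasurable C (Eventually.of_forall hC)

theorem integral_toMeasure [Group G] [Countable G] [DiscreteMeasurableSpace G] (ν : ProbSpace G)
    {a : G → ℝ} {C : ℝ} (ha : ∀ g, |a g| ≤ C) : ∫ g, a g ∂ν.toMeasure = ν.mean a := by
  rw [integral_countable (integrable_of_abs_le Measurable.of_discrete ha), ProbSpace.mean]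
  refine tsum_congr fun g => ?_
  rw [measureReal_def, toMeasure_singleton, ENNReal.toReal_ofReal (ν.2.1 g), smul_eq_mul]

/-- Fubini, splitting off one increment at a time by `map_consSeq`. -/
theorem integral_infinitePi_eq_expect [Group G] [Countable G] [DiscreteMeasurableSpace G]
    (ν : ProbSpace G) (n : ℕ) {Φ : (ℕ → G) → ℝ} (hΦ : Measurable Φ) {C : ℝ}
    (hC : ∀ x, |Φ x| ≤ C) :
    ∫ x, Φ x ∂(Measure.infinitePi fun _ : ℕ => ν.toMeasure) = ν.expect n fun l =>
      ∫ x, Φ (appendSeq l x) ∂(Measure.infinitePi fun _ : ℕ => ν.toMeasure) := by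
  induction n generalizing Φ with
  | zero => rfl
  | succ n ih =>
    have hm : Measurable (fun p => Φ (consSeq p)) := hΦ.comp measurable_consSeq
    rw [← map_consSeq ν.toMeasure, integral_map measurable_consSeq.aemeasurable
      hΦ.aestronglyMeasurable, integral_prod _ (integrable_of_abs_le hm fun p => hC _),
      integral_toMeasure ν (C := C) fun g => ?_, ProbSpace.expect, map_consSeq]
    · congr 1
      funext g
      exact ih (Φ := fun x => Φ (consSeq (g, x)))
        (hm.comp (measurable_const.prodMk measurable_id)) fun x => hC _
    · have h := norm_integral_le_of_norm_le_const
        (μ := Measure.infinitePi fun _ : ℕ => ν.toMeasure) (f := fun x => Φ (consSeq (g, x)))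
        (C := C) (Eventually.of_forall fun x => hC _)
      simpa using h

end

end RandomWalk

/-! ### Stabilizers of points of the Poisson boundary -/

namespace RandomWalk

variable {G : Type u} [Group G] [Countable G] [MeasurableSpace G] [DiscreteMeasurableSpace G]

theorem abs_indicator_one_le {X : Type*} (A : Set X) (x : X) :
    |A.indicator (1 : X → ℝ) x| ≤ 1 := by
  by_cases h : x ∈ A <;> simp [h]

theorem indicator_one_mem_Icc {X : Type*} (A : Set X) (x : X) :
    A.indicator (1 : X → ℝ) x ∈ Set.Icc (0 : ℝ) 1 := by
  by_cases h : x ∈ A <;> simp [h]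

/-- The weighted difference between a tail set and its translate is small, if the tail set is
approximated by a set `D` depending on the increments before the swap. -/
theorem integral_swap_le (ν : ProbSpace G) {s : G} {M N : ℕ} (hMN : M ≤ N) {w : List G → ℝ}
    (hw0 : ∀ l, 0 ≤ w l) (hw1 : ∀ l, w l ≤ 1) {ε : ℝ}
    (hswap : ∀ φ : List G → G → ℝ, (∀ l y, φ l y ∈ Set.Icc (0 : ℝ) 1) →
      |ν.expect N fun l => w l * (φ (l.take M) l.prod - φ (l.take M) (s * l.prod))| ≤ ε)
    {A : Set (ℕ → G)} (hA : MeasurableSet[tail G] A) {D : Set (ℕ → G)} (hD : MeasurableSet D)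
    (hDM : ∀ x y : ℕ → G, (∀ i < M, x i = y i) → (x ∈ D ↔ y ∈ D))
    (hAD : (Measure.infinitePi fun _ : ℕ => ν.toMeasure) (symmDiff (positions ⁻¹' A) D) ≤
      ENNReal.ofReal ε) (hε : 0 ≤ ε) :
    ∫ x, w (takeSeq N x) * |A.indicator (1 : (ℕ → G) → ℝ) (positions x) -
      A.indicator (1 : (ℕ → G) → ℝ) (translate s (positions x))|
      ∂(Measure.infinitePi fun _ : ℕ => ν.toMeasure) ≤ 3 * ε := by
  set P := Measure.infinitePi fun _ : ℕ => ν.toMeasure with hP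
  have hAm : MeasurableSet A := tail_le _ hA
  -- As a tail event, `A` is a condition `B` on the path from index `N` on, that is, on the walk
  -- restarted at the product of the first `N` increments.
  obtain ⟨B, hB, hBA⟩ := exists_preimage_of_fromTime
    ((MeasurableSpace.measurableSet_iInf.1 hA) N)
  set a : (ℕ → G) → ℝ := fun x => A.indicator 1 (positions x) with ha
  set b : (ℕ → G) → ℝ := fun x => A.indicator 1 (translate s (positions x)) with hb
  set d : (ℕ → G) → ℝ := D.indicator 1 with hd
  set W : (ℕ → G) → ℝ := fun x => w (takeSeq N x) with hW
  have hA1 : Measurable (A.indicator (1 : (ℕ → G) → ℝ)) := measurable_one.indicator hAm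
  have hB1 : Measurable (B.indicator (1 : (ℕ → G) → ℝ)) := measurable_one.indicator hB
  have ham : Measurable a := hA1.comp measurable_positions
  have hbm : Measurable b := hA1.comp ((measurable_translate s).comp measurable_positions)
  have hdm : Measurable d := measurable_one.indicator hD
  have hWm : Measurable W := measurable_comp_takeSeq N w
  have ha01 : ∀ x, a x ∈ Set.Icc (0 : ℝ) 1 := fun x => indicator_one_mem_Icc _ _
  have hb01 : ∀ x, b x ∈ Set.Icc (0 : ℝ) 1 := fun x => indicator_one_mem_Icc _ _
  have hd01 : ∀ x, d x ∈ Set.Icc (0 : ℝ) 1 := fun x => indicator_one_mem_Icc _ _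
  have hW0 : ∀ x, 0 ≤ W x := fun x => hw0 _
  have hW1 : ∀ x, W x ≤ 1 := fun x => hw1 _
  have hd2 : ∀ x, |1 - 2 * d x| ≤ 1 := fun x =>
    abs_le.2 ⟨by linarith [(hd01 x).2], by linarith [(hd01 x).1]⟩
  have hsub : ∀ {x y : ℝ}, x ∈ Set.Icc (0 : ℝ) 1 → y ∈ Set.Icc (0 : ℝ) 1 → |x - y| ≤ 1 :=
    fun hx hy => abs_le.2 ⟨by linarith [hx.1, hy.2], by linarith [hx.2, hy.1]⟩
  have had : ∫ x, |a x - d x| ∂P ≤ ε := by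
    have e : (fun x => |a x - d x|) = (symmDiff (positions ⁻¹' A) D).indicator 1 := by
      funext x
      by_cases h1 : positions x ∈ A <;> by_cases h2 : x ∈ D <;>
        simp [ha, hd, h1, h2, Set.mem_symmDiff]
    rw [e, integral_indicator_one ((measurable_positions hAm).symmDiff hD), measureReal_def]
    exact ENNReal.toReal_le_of_le_ofReal hε hAD
  set Φ : (ℕ → G) → ℝ := fun x => W x * ((1 - 2 * d x) * (a x - b x)) with hΦ
  have hΦm : Measurable Φ :=
    hWm.mul (((hdm.const_mul 2).const_sub 1).mul (ham.sub hbm))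
  have hΦ1 : ∀ x, |Φ x| ≤ 1 := fun x => by
    simp only [hΦ, abs_mul]
    rw [abs_of_nonneg (hW0 x)]
    exact mul_le_one₀ (hW1 x) (by positivity)
      (mul_le_one₀ (hd2 x) (abs_nonneg _) (hsub (ha01 x) (hb01 x)))
  have hsw : |∫ x, Φ x ∂P| ≤ ε := by
    set f : G → ℝ := fun z => ∫ y, B.indicator (1 : (ℕ → G) → ℝ) (translate z (positions y)) ∂P with hf
    have hfi : ∀ z, Integrable
        (fun y => B.indicator (1 : (ℕ → G) → ℝ) (translate z (positions y))) P := fun z =>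
      integrable_of_abs_le (hB1.comp ((measurable_translate z).comp measurable_positions))
        fun y => abs_indicator_one_le _ _
    have hf01 : ∀ z, f z ∈ Set.Icc (0 : ℝ) 1 := fun z =>
      ⟨integral_nonneg fun y => (indicator_one_mem_Icc _ _).1, by
        simpa using integral_mono (hfi z) (integrable_const (1 : ℝ)) fun y =>
          (indicator_one_mem_Icc _ _).2⟩
    -- With `f z` the probability of `B` for the walk started at `z`, this is the conditional
    -- probability that `A` and `D` disagree. The summand `d` keeps it in `[0, 1]` and cancels in
    -- the difference.
    have h := hswap (fun l z => d (appendSeq l 1) + (1 - 2 * d (appendSeq l 1)) * f z)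
      fun l z => by
        have h1 := hd01 (appendSeq l 1)
        have h2 := hf01 z
        constructor
        · nlinarith [h1.1, h1.2, h2.1, h2.2, mul_nonneg (sub_nonneg.2 h1.2) h2.1,
            mul_nonneg h1.1 (sub_nonneg.2 h2.2)]
        · nlinarith [h1.1, h1.2, h2.1, h2.2, mul_nonneg (sub_nonneg.2 h1.2) (sub_nonneg.2 h2.2),
            mul_nonneg h1.1 h2.1]
    rw [hP, integral_infinitePi_eq_expect ν N hΦm hΦ1, ← hP]
    convert h using 2
    refine ν.expect_congr N fun l hl => ?_
    have e : ∀ y, Φ (appendSeq l y) = w l * (1 - 2 * d (appendSeq (l.take M) 1)) *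
        (B.indicator 1 (translate l.prod (positions y)) -
          B.indicator 1 (translate (s * l.prod) (positions y))) := by
      intro y
      have h1 : W (appendSeq l y) = w l := by
        simp only [hW, ← hl, takeSeq_appendSeq]
      have h2 : d (appendSeq l y) = d (appendSeq (l.take M) 1) := by
        have := hDM (appendSeq (l.take M) 1) (appendSeq l y) fun i hi =>
          appendSeq_take_apply l 1 y (by omega) hi
        by_cases hx : appendSeq l y ∈ D
        · simp [hd, hx, this.2 hx]
        · simp [hd, hx, mt this.1 hx]
      have h3 : a (appendSeq l y) = B.indicator 1 (translate l.prod (positions y)) := by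
        have : (fun i => positions (appendSeq l y) (N + i)) = translate l.prod (positions y) := by
          funext i
          rw [← hl, positions_appendSeq]
          rfl
        simp only [ha, ← hBA, ← this]
        rfl
      have h4 : b (appendSeq l y) = B.indicator 1 (translate (s * l.prod) (positions y)) := by
        have : (fun i => translate s (positions (appendSeq l y)) (N + i)) =
            translate (s * l.prod) (positions y) := by
          funext i
          rw [translate, ← hl, positions_appendSeq, ← mul_assoc]
          rfl
        simp only [hb, ← hBA, ← this]
        rfl
      simp only [hΦ]
      rw [h1, h2, h3, h4, mul_assoc]
    simp only [e]
    rw [integral_const_mul, integral_sub (hfi _) (hfi _)]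
    ring
  have hWadm : Measurable fun x => |a x - d x| := (ham.sub hdm).abs
  have hi1 : Integrable (fun x => |a x - d x|) P :=
    integrable_of_abs_le hWadm (C := 1) fun x => by
      rw [abs_abs]; exact hsub (ha01 x) (hd01 x)
  have hi2 : Integrable Φ P := integrable_of_abs_le hΦm hΦ1
  -- Pass from `a` to `b` through `d`. For values in `{0, 1}`, `|d - b| = d + (1 - 2 * d) * b`, and
  -- likewise for `a`, so `Φ` is exactly the weighted change of `|d - ·|` under the swap.
  have hpt : ∀ x, W x * |a x - b x| ≤ 2 * |a x - d x| - Φ x := by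
    intro x
    have hda : d x * (1 - a x) + (1 - d x) * a x = |a x - d x| ∧
        |d x - b x| = d x * (1 - b x) + (1 - d x) * b x := by
      simp only [ha, hb, hd]
      by_cases h1 : positions x ∈ A <;> by_cases h2 : x ∈ D <;>
        by_cases h3 : translate s (positions x) ∈ A <;> simp [h1, h2, h3]
    have h1 := abs_sub_le (a x) (d x) (b x)
    have h2 := mul_le_mul_of_nonneg_left h1 (hW0 x)
    have h3 : W x * |a x - d x| ≤ |a x - d x| := mul_le_of_le_one_left (abs_nonneg _) (hW1 x)
    have h4 : W x * |d x - b x| = W x * |a x - d x| - Φ x := by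
      simp only [hΦ]
      rw [hda.2, ← hda.1]
      ring
    rw [mul_add] at h2
    linarith
  calc ∫ x, W x * |a x - b x| ∂P ≤ ∫ x, (2 * |a x - d x| - Φ x) ∂P := by
        refine integral_mono (integrable_of_abs_le (hWm.mul (ham.sub hbm).abs) (C := 1) fun x => ?_)
          ((hi1.const_mul 2).sub hi2) hpt
        rw [abs_mul, abs_abs, abs_of_nonneg (hW0 x)]
        exact mul_le_one₀ (hW1 x) (abs_nonneg _) (hsub (ha01 x) (hb01 x))
    _ = 2 * ∫ x, |a x - d x| ∂P - ∫ x, Φ x ∂P := by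
        rw [integral_sub (hi1.const_mul 2) hi2, integral_const_mul]
    _ ≤ 3 * ε := by linarith [(abs_le.1 hsw).1]

/-- Finitely many tail sets cannot separate almost every path from all its translates by `S`. -/
theorem measure_iInter_symmDiff_eq_zero (ν : ProbSpace G) {S : Finset G}
    (hν : ∀ M : ℕ, ∀ ε : ℝ, 0 < ε → ∃ ε' ≤ ε, ν.IsSwapping S M ε') {A : ℕ → Set (ℕ → G)}
    (hA : ∀ i, MeasurableSet[tail G] (A i)) (m : ℕ) :
    pathMeasure ν (⋂ s ∈ S, ⋃ i ∈ Finset.range m, symmDiff (A i) (translate s ⁻¹' A i)) = 0 := by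
  have hAm : ∀ i, MeasurableSet (A i) := fun i => tail_le _ (hA i)
  set E := ⋂ s ∈ S, ⋃ i ∈ Finset.range m, symmDiff (A i) (translate s ⁻¹' A i) with hE
  have hEm : MeasurableSet E := Finset.measurableSet_biInter _ fun s _ =>
    Finset.measurableSet_biUnion _ fun i _ => (hAm i).symmDiff (measurable_translate s (hAm i))
  rw [pathMeasure, Measure.map_apply measurable_positions hEm]
  set P := Measure.infinitePi fun _ : ℕ => ν.toMeasure with hP
  -- One `ε` accounts for the missing weight, and `3 * ε` for each pair of an `s ∈ S` and one of the
  -- `m` tail sets.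
  have key : ∀ ε : ℝ, 0 < ε → P.real (positions ⁻¹' E) ≤ (1 + S.card * (m * 3)) * ε := by
    intro ε hε
    choose M D hD hDM hAD using fun i =>
      exists_approx_of_finitely_many_coordinates P (measurable_positions (hAm i)) hε
    -- One time after which the swap leaves all `m` approximating sets unchanged.
    set M' := (Finset.range m).sup M with hM'
    obtain ⟨ε', hε', N, hMN, w, hw0, hw1, hmass, hswap⟩ := hν M' ε hε
    have hws : ∀ s ∈ S, ∀ l, w s l ≤ 1 := fun s hs l =>
      (Finset.single_le_sum (f := fun s => w s l) (fun s _ => hw0 s l) hs).trans (hw1 l)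
    set u : G → ℕ → (ℕ → G) → ℝ := fun s i x => w s (takeSeq N x) *
      |(A i).indicator (1 : (ℕ → G) → ℝ) (positions x) -
        (A i).indicator (1 : (ℕ → G) → ℝ) (translate s (positions x))| with hu
    have hA1 : ∀ i, Measurable ((A i).indicator (1 : (ℕ → G) → ℝ)) := fun i =>
      measurable_one.indicator (hAm i)
    have hum : ∀ s i, Measurable (u s i) := fun s i =>
      (measurable_comp_takeSeq N (w s)).mul (((hA1 i).comp measurable_positions).sub
        ((hA1 i).comp ((measurable_translate s).comp measurable_positions))).abs
    have hu0 : ∀ s i x, 0 ≤ u s i x := fun s i x => mul_nonneg (hw0 _ _) (abs_nonneg _)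
    have hui : ∀ s ∈ S, ∀ i, Integrable (u s i) P := fun s hs i =>
      integrable_of_abs_le (hum s i) (C := 1) fun x => by
        rw [abs_of_nonneg (hu0 s i x)]
        refine mul_le_one₀ (hws s hs _) (abs_nonneg _) (abs_le.2 ⟨?_, ?_⟩) <;>
        linarith [(indicator_one_mem_Icc (A i) (positions x)).1,
          (indicator_one_mem_Icc (A i) (positions x)).2,
          (indicator_one_mem_Icc (A i) (translate s (positions x))).1,
          (indicator_one_mem_Icc (A i) (translate s (positions x))).2]
    have huint : ∀ s ∈ S, ∀ i ∈ Finset.range m, ∫ x, u s i x ∂P ≤ 3 * ε := fun s hs i hi =>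
      integral_swap_le ν hMN (hw0 s) (hws s hs)
        (fun φ hφ => (hswap s hs φ hφ).trans hε') (hA i) (hD i)
        (fun x y hxy => hDM i x y fun j hj => hxy j (hj.trans_le (Finset.le_sup (f := M) hi)))
        (hAD i).le hε.le
    set T : (ℕ → G) → ℝ := fun x => ∑ s ∈ S, w s (takeSeq N x) with hT
    have hTm : Measurable T := measurable_comp_takeSeq N fun l => ∑ s ∈ S, w s l
    have hT0 : ∀ x, 0 ≤ T x := fun x => Finset.sum_nonneg fun s _ => hw0 _ _
    have hT1 : ∀ x, |T x| ≤ 1 := fun x => by rw [abs_of_nonneg (hT0 x)]; exact hw1 _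
    have hTi : Integrable T P := integrable_of_abs_le hTm hT1
    have hTint : 1 - ε ≤ ∫ x, T x ∂P := by
      rw [hP, integral_infinitePi_eq_expect ν N hTm hT1]
      refine le_trans (by linarith) (hmass.trans (le_of_eq ?_))
      refine ν.expect_congr N fun l hl => ?_
      simp only [hT, ← hl, takeSeq_appendSeq]
      simp
    -- On `E` every `s` is detected by some `i`, so the double sum is at least `T x`; off `E` the
    -- bound `T x ≤ 1` suffices.
    have hpt : ∀ x, (positions ⁻¹' E).indicator (1 : (ℕ → G) → ℝ) x ≤
        1 - T x + ∑ s ∈ S, ∑ i ∈ Finset.range m, u s i x := by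
      intro x
      by_cases hx : positions x ∈ E
      · have h1 : ∀ s ∈ S, w s (takeSeq N x) ≤ ∑ i ∈ Finset.range m, u s i x := by
          intro s hs
          simp only [hE, Set.mem_iInter, Set.mem_iUnion] at hx
          obtain ⟨i, hi, hxi⟩ := hx s hs
          refine le_trans (le_of_eq ?_)
            (Finset.single_le_sum (f := fun i => u s i x) (fun i _ => hu0 s i x) hi)
          simp only [hu]
          rcases hxi with ⟨h1, h2⟩ | ⟨h1, h2⟩
          · rw [Set.mem_preimage] at h2
            simp [h1, h2]
          · rw [Set.mem_preimage] at h1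
            simp [h1, h2]
        have h2 := Finset.sum_le_sum h1
        rw [Set.indicator_of_mem (by exact hx)]
        simp only [hT, Pi.one_apply]
        linarith
      · rw [Set.indicator_of_notMem (by exact hx)]
        have h1 : 0 ≤ ∑ s ∈ S, ∑ i ∈ Finset.range m, u s i x :=
          Finset.sum_nonneg fun s _ => Finset.sum_nonneg fun i _ => hu0 s i x
        linarith [(abs_le.1 (hT1 x)).2]
    have hSi : ∀ s ∈ S, Integrable (fun x => ∑ i ∈ Finset.range m, u s i x) P := fun s hs =>
      integrable_finsetSum _ fun i _ => hui s hs i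
    have hSS : Integrable (fun x => ∑ s ∈ S, ∑ i ∈ Finset.range m, u s i x) P :=
      integrable_finsetSum _ hSi
    have h1 : Integrable (fun x => 1 - T x) P := (integrable_const 1).sub hTi
    have hmE : MeasurableSet (positions ⁻¹' E) := measurable_positions hEm
    have h2 := integral_mono
      ((integrable_const (1 : ℝ)).indicator (μ := P) hmE) (h1.add hSS) hpt
    rw [show (fun x => (positions ⁻¹' E).indicator (fun _ => (1 : ℝ)) x) =
      (positions ⁻¹' E).indicator 1 from rfl, integral_indicator_one hmE] at h2
    simp only [Pi.add_apply] at h2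
    rw [integral_add h1 hSS, integral_sub (integrable_const _) hTi,
      integral_finsetSum _ hSi] at h2
    have h3 : ∑ s ∈ S, ∫ x, ∑ i ∈ Finset.range m, u s i x ∂P ≤ S.card * (m * (3 * ε)) := by
      refine (Finset.sum_le_card_nsmul _ _ (m * (3 * ε)) fun s hs => ?_).trans_eq (by simp)
      rw [integral_finsetSum _ fun i _ => hui s hs i]
      exact (Finset.sum_le_card_nsmul _ _ (3 * ε) fun i hi => huint s hs i hi).trans_eq (by simp)
    simp only [integral_const, probReal_univ, one_smul] at h2
    linarith
  have hzero : P.real (positions ⁻¹' E) ≤ 0 := by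
    refine le_of_forall_pos_le_add fun η hη => ?_
    have hc : (0 : ℝ) < 1 + S.card * (m * 3) := by positivity
    refine (key (η / (1 + S.card * (m * 3))) (by positivity)).trans_eq ?_
    rw [mul_div_cancel₀ _ hc.ne', zero_add]
  exact (measureReal_eq_zero_iff).1 (le_antisymm hzero measureReal_nonneg)

/-- A countable family of Borel sets separating the points of `B` is pulled back to tail events; if
all of them agree at `ω` and `s ω`, then `s` fixes `π ω`. -/
theorem boundaryStabilizersMeet (ν : ProbSpace G) (hfull : ∀ g, ν.1 g ≠ 0) {S : Finset G}
    (hν : ∀ M : ℕ, ∀ ε : ℝ, 0 < ε → ∃ ε' ≤ ε, ν.IsSwapping S M ε') :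
    BoundaryStabilizersMeet.{u, v} ν S := by
  intro B _ _ _ π h
  obtain ⟨C, hC, hsep⟩ := exists_seq_separating B (p := MeasurableSet) MeasurableSet.empty Set.univ
  choose A hA hAC using fun i => h.preimage_tail (C i) (hC i)
  have hsm : ∀ s : G, Measurable fun b : B => s • b := fun s => (h.quasiInvariant s).measurable
  have hset : MeasurableSet {b : B | ((S : Set G) ∩ MulAction.stabilizer G b).Nonempty} := by
    have : {b : B | ((S : Set G) ∩ MulAction.stabilizer G b).Nonempty} =
        ⋃ s ∈ S, {b : B | s • b = b} := by
      ext b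
      simp [Set.Nonempty]
    rw [this]
    exact Finset.measurableSet_biUnion _ fun s _ => measurableSet_eq_fun (hsm s) measurable_id
  rw [ae_map_iff h.measurable_map.aemeasurable hset]
  have hq : ∀ s : G, Measure.QuasiMeasurePreserving (translate s) (pathMeasure ν) (pathMeasure ν) :=
    fun s => ⟨measurable_translate s, map_translate_absolutelyContinuous ν hfull s⟩
  have h1 : ∀ᵐ ω ∂(pathMeasure ν), ∀ i, (π ω ∈ C i ↔ ω ∈ A i) :=
    ae_all_iff.2 fun i => (hAC i).mem_iff
  -- Agreement of `C i` with `A i` is also needed along translated paths; full support makes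
  -- translation preserve null sets.
  have h2 : ∀ᵐ ω ∂(pathMeasure ν), ∀ (s : G) (i : ℕ),
      (π (translate s ω) ∈ C i ↔ translate s ω ∈ A i) :=
    ae_all_iff.2 fun s => (hq s).ae h1
  have h3 : ∀ᵐ ω ∂(pathMeasure ν), ∀ s : G, π (translate s ω) = s • π ω :=
    ae_all_iff.2 h.equivariant
  have h4 : ∀ᵐ ω ∂(pathMeasure ν), ∀ m,
      ω ∉ ⋂ s ∈ S, ⋃ i ∈ Finset.range m, symmDiff (A i) (translate s ⁻¹' A i) :=
    ae_all_iff.2 fun m => measure_eq_zero_iff_ae_notMem.1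
      (measure_iInter_symmDiff_eq_zero ν hν hA m)
  filter_upwards [h1, h2, h3, h4] with ω h1 h2 h3 h4
  by_contra hne
  have hdiff : ∀ s ∈ S, ∃ i, ω ∈ symmDiff (A i) (translate s ⁻¹' A i) := by
    intro s hs
    by_contra! hs'
    refine hne ⟨s, hs, hsep _ trivial _ trivial fun i => ?_⟩
    have h5 := hs' i
    rw [Set.mem_symmDiff, Set.mem_preimage, ← h1 i, ← h2 s i, h3 s] at h5
    tauto
  choose! i hi using hdiff
  -- Since `S` is finite, one bound covers the indices that separate `ω` from all its translates.
  refine h4 (S.sup i + 1) ?_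
  simp only [Set.mem_iInter, Set.mem_iUnion]
  exact fun s hs => ⟨i s, Finset.mem_range.2 (Nat.lt_succ_of_le (Finset.le_sup hs)), hi s hs⟩

end RandomWalk

theorem mainTheorem4 {G : Type u} [Group G] [Countable G] [MeasurableSpace G]
    [DiscreteMeasurableSpace G] (S : Finset G) (hS : S.Nonempty) (hvis : AmenablyVisible S) :
    (∀ᶠ ν in residual (ProbSpace G),
      ν.IsNondegenerate ∧ HasPoissonBoundary ν ∧ BoundaryStabilizersMeet.{u, v} ν S) ∧
    (∀ᶠ ν in residual {ν : ProbSpace G // ν.IsSymmetric},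
      ν.1.IsNondegenerate ∧ HasPoissonBoundary ν.1 ∧ BoundaryStabilizersMeet.{u, v} ν.1 S) := by
  constructor
  · filter_upwards [ProbSpace.eventually_residual_isSwapping (f := id) isometry_id
      (fun _ _ _ _ _ _ => ⟨_, rfl⟩) hvis] with ν hν
    exact ⟨ProbSpace.isNondegenerate_of_full_support hν.1, hasPoissonBoundary ν hν.1,
      boundaryStabilizersMeet ν hν.1 hν.2⟩
  · filter_upwards [ProbSpace.eventually_residual_isSwapping
      (f := (Subtype.val : {ν : ProbSpace G // ν.IsSymmetric} → ProbSpace G)) isometry_subtype_coe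
      (fun ν _ h0 h1 _ hμ => ⟨⟨_, ν.2.mix h0 h1 hμ⟩, rfl⟩) hvis] with ν hν
    exact ⟨ProbSpace.isNondegenerate_of_full_support hν.1, hasPoissonBoundary ν.1 hν.1,
      boundaryStabilizersMeet ν.1 hν.1 hν.2⟩
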